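/- Consider tabular episodic MDPs with $S$ states, $A$ actions and horizon $H$: an unknown initial distribution $\mathbb P_1$, unknown transition kernels $\mathbb P_h(\cdot\mid s,a)$, $h\in[H]$, and rewards $r_h(s,a)\in[0,1]$. A policy may be randomized and history-dependent: it draws a random seed $\xi$ and plays $a_h=\pi_h(s_1,\dots,s_h,a_1,\dots,a_{h-1},\xi)$; its value $V^{\pi}(\mathbb P,r)$ is the expected total reward of one episode. A (randomized) reward-free exploration algorithm $\mathrm{Alg}$ interacts with the MDP without observing rewards for a random number $K\in\{0,1,\dots,\infty\}$ of episodes; each action, and the decision to stop, may depend on its internal randomness and on everything observed so far. After it stops, given any finite sequence of reward functions $r^{(1)},\dots,r^{(N)}$, it returns (possibly randomized, history-dependent) policies $\pi^{(1)},\dots,\pi^{(N)}$ without further interaction. Call an MDP or a reward function stage-invariant if $\mathbb P_h$, respectively $r_h$, does not depend on $h$. There are universal constants $C,c>0$ such that the following holds for all integers $A\ge 2$, $S\ge C\log_2 A$, $H\ge C\log_2 S$ and all $0<\epsilon\le\min\{1/4,H/48\}$. Suppose that for every stage-invariant MDP $\mathbb P$ with $S$ states, $A$ actions and horizon $H$,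 and for every finite sequence $r^{(1)},\dots,r^{(N)}$ of stage-invariant reward functions, with probability at least $1/2$ the algorithm stops and $$V^{\pi^{(i)}}(\mathbb P,r^{(i)})\ \ge\ \sup_{\pi}V^{\pi}(\mathbb P,r^{(i)})-\epsilon\qquad\text{for all } i=1,\dots,N .$$ Then there is a stage-invariant MDP $\mathbb P$ on which $$\mathbf E_{\mathbb P,\mathrm{Alg}}[K]\ \ge\ c\,\frac{S^2AH^2}{\epsilon^2}.$$ In particular, the bound holds for every algorithm that outputs, with probability at least $1/2$, $\epsilon$-optimal policies for arbitrarily many adaptively chosen (possibly stage-dependent) rewards on every (possibly stage-dependent) MDP. -/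

import Mathlib

open MeasureTheory
open scoped ENNReal

namespace RewardFree

/-- A reward-free tabular episodic Markov decision process with states `Fin S`, actions `Fin A` and
horizon `H`: an initial distribution and stage-dependent transition kernels. Stages `1, …, H` are
indexed by `Fin H`. -/
structure MDP (S A H : ℕ) where
  init : PMF (Fin S)
  trans : Fin H → Fin S → Fin A → PMF (Fin S)

/-- The transition kernels are identical across stages. -/
def MDP.StageInvariant {S A H : ℕ} (M : MDP S A H) : Prop :=
  ∀ h h' : Fin H, M.trans h = M.trans h'

/-- Deterministic reward functions `r_h : 𝒮 × 𝒜 → [0, 1]`. -/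
abbrev Reward (S A H : ℕ) : Type := Fin H → Fin S → Fin A → Set.Icc (0 : ℝ) 1

/-- The reward function is identical across stages. -/
def Reward.StageInvariant {S A H : ℕ} (r : Reward S A H) : Prop :=
  ∀ h h' : Fin H, r h = r h'

/-- The trajectory of one episode: the states `s_1, …, s_{H+1}` and the actions `a_1, …, a_H`. -/
abbrev Traj (S A H : ℕ) : Type := (Fin (H + 1) → Fin S) × (Fin H → Fin A)

/-- History-dependent, non-randomized decision rules for one episode: at each stage `h` a map
`(s_1, …, s_h, a_1, …, a_{h-1}) ↦ a_h`. -/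
abbrev DetPolicy (S A H : ℕ) : Type :=
  (h : Fin H) → (Fin (h.val + 1) → Fin S) → (Fin h.val → Fin A) → Fin A

/-- Randomized history-dependent policies `(s_1, …, s_h, a_1, …, a_{h-1}, ξ) ↦ a_h`, where the
random seed `ξ` is drawn at the start of the episode. Such a policy is determined by the law of the
decision rule obtained by fixing `ξ`. -/
abbrev Policy (S A H : ℕ) : Type := PMF (DetPolicy S A H)

/-- The action that `d` prescribes at stage `h` on the history contained in `τ`. -/
def DetPolicy.act {S A H : ℕ} (d : DetPolicy S A H) (τ : Traj S A H) (h : Fin H) : Fin A :=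
  d h (fun j => τ.1 ⟨j.val, by omega⟩) (fun j => τ.2 ⟨j.val, by omega⟩)

/-- The probability of the trajectory `τ` when `d` is played for one episode of `M`. -/
noncomputable def trajProb {S A H : ℕ} (M : MDP S A H) (d : DetPolicy S A H) (τ : Traj S A H) :
    ℝ≥0∞ :=
  M.init (τ.1 0) *
    ∏ h : Fin H,
      if τ.2 h = d.act τ h then M.trans h (τ.1 h.castSucc) (τ.2 h) (τ.1 h.succ) else 0

/-- The total reward `∑_{h = 1}^H r_h(s_h, a_h)` of a trajectory. -/
noncomputable def totalReward {S A H : ℕ} (r : Reward S A H) (τ : Traj S A H) : ℝ :=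
  ∑ h : Fin H, (r h (τ.1 h.castSucc) (τ.2 h) : ℝ)

/-- The value `E_{s_1 ∼ P_1} [V_1^π(s_1; r)]`, that is, the expected total reward of the randomized
history-dependent policy `π` in `M`. -/
noncomputable def value {S A H : ℕ} (M : MDP S A H) (r : Reward S A H) (π : Policy S A H) : ℝ :=
  ∑ d : DetPolicy S A H, (π d).toReal *
    ∑ τ : Traj S A H, (trajProb M d τ).toReal * totalReward r τ

/-- `π` is `ε`-optimal for `M` with reward `r`, among all randomized history-dependent policies. -/
def IsEpsOptimal {S A H : ℕ} (M : MDP S A H) (r : Reward S A H) (ε : ℝ) (π : Policy S A H) :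
    Prop :=
  ∀ π' : Policy S A H, value M r π' - ε ≤ value M r π

/-- A randomized reward-free exploration algorithm. All its internal randomness (for exploration,
stopping and planning) is one seed `ω`, drawn from an arbitrary probability space.

* Exploration: after the episodes in the list `D` (oldest first), the algorithm either stops
  (`explore ω D = none`), or plays one more episode with the history-dependent rule `d`
  (`explore ω D = some d`). So every action may depend on the seed, on all previous episodes and on
  the current episode up to that point, and the number of episodes is random.
* Planning: given the final dataset and rewards `r^(1), …, r^(N)`, it returns randomized
  history-dependent policies `π^(1), …, π^(N)`. -/
structure Algorithm (S A H : ℕ) where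
  Seed : Type*
  [measurableSpace : MeasurableSpace Seed]
  seedLaw : Measure Seed
  [isProbabilityMeasure : IsProbabilityMeasure seedLaw]
  explore : Seed → List (Traj S A H) → Option (DetPolicy S A H)
  plan : Seed → List (Traj S A H) → (N : ℕ) → (Fin N → Reward S A H) → Fin N → Policy S A H
  measurable_explore : ∀ (D : List (Traj S A H)) (o : Option (DetPolicy S A H)),
    MeasurableSet {ω : Seed | explore ω D = o}
  measurable_plan : ∀ (D : List (Traj S A H)) (N : ℕ) (r : Fin N → Reward S A H) (i : Fin N)
    (d : DetPolicy S A H), Measurable fun ω : Seed => plan ω D N r i d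

attribute [instance] Algorithm.measurableSpace Algorithm.isProbabilityMeasure

namespace Algorithm

variable {S A H : ℕ} (alg : Algorithm S A H) (M : MDP S A H)

/-- Given the seed `ω`, the probability that the algorithm, run on `M`, plays at least `D.length`
episodes and that the first `D.length` trajectories are those in `D`. -/
noncomputable def dataProb (ω : alg.Seed) (D : List (Traj S A H)) : ℝ≥0∞ :=
  ∏ k : Fin D.length,
    match alg.explore ω (D.take k.val) with
    | none => 0
    | some d => trajProb M d (D.get k)

open Classical in
/-- `P(K > k)`: the probability that the algorithm, run on `M`, does not stop within the first `k`
episodes. -/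
noncomputable def probMoreThan (k : ℕ) : ℝ≥0∞ :=
  ∫⁻ ω, ∑' D : List (Traj S A H),
    (if D.length = k ∧ alg.explore ω D ≠ none then alg.dataProb M ω D else 0) ∂alg.seedLaw

/-- The expectation `E[K] = ∑_{k ≥ 0} P(K > k)` in `[0, ∞]` of the number `K ∈ {0, 1, …, ∞}` of
trajectories that the algorithm collects when run on `M`. -/
noncomputable def expectedEpisodes : ℝ≥0∞ :=
  ∑' k : ℕ, alg.probMoreThan M k

open Classical in
/-- The probability (over the internal randomness and the collected trajectories) that the
algorithm, run on `M`, stops and, when queried with the rewards `r^(1), …, r^(N)`, returns policies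
that are all `ε`-optimal. -/
noncomputable def successProb (ε : ℝ) (N : ℕ) (r : Fin N → Reward S A H) : ℝ≥0∞ :=
  ∫⁻ ω, ∑' D : List (Traj S A H),
    (if alg.explore ω D = none ∧ ∀ i, IsEpsOptimal M (r i) ε (alg.plan ω D N r i)
      then alg.dataProb M ω D else 0) ∂alg.seedLaw

/-- The algorithm `(ε, p)`-learns the problem class given by the reward-free MDPs `𝓜` and the
rewards `𝓡`: on every `M ∈ 𝓜`, for every finite sequence of rewards from `𝓡`, all returned policies
are `ε`-optimal with probability at least `1 - p`. -/
def Learns (𝓜 : Set (MDP S A H)) (𝓡 : Set (Reward S A H)) (ε p : ℝ) : Prop :=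
  ∀ M ∈ 𝓜, ∀ (N : ℕ) (r : Fin N → Reward S A H), (∀ i, r i ∈ 𝓡) →
    ENNReal.ofReal (1 - p) ≤ alg.successProb M ε N r

end Algorithm

end RewardFree

/-!
The hard instances consist of a binary tree that is traversed deterministically from the root to
one of `n` leaves, where `n` is of order `S`; this lets a reward single out one leaf. Playing an
action in a leaf yields an outcome, which is an absorbing state in which the remaining `t ≥ H / 2`
stages are spent. Thus one episode is one pull of an arm (leaf, action) chosen by the learner
(`TreeLayout.trajProb_run`). The leftmost leaf leads to a known state. In every other arm the
outcome is uniform on `m = n / 2` pairs of states, up to a tilt: within each pair one state has its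
mass multiplied by `1 + e`, the other by `1 - e`, with `e = 24 ε / t`. Which of the two is
favoured is an unknown bit, so the parameter `θ` of an instance has about `n * A * m` bits, which is
of order `S ^ 2 * A`.

*The policies reveal the parameter.* For an arm `x` and a guess `u` of its tilt, `TreeLayout.query`
is the reward that pays `1` for playing `x`, pays in each later stage if the outcome is favoured by
`u`, and makes the leftmost leaf almost as good as `x` would be if `u` were correct. If `u` is
correct, an `ε`-optimal policy plays `x` with probability at least `3 / 4`; conversely, a policy
that plays `x` this often is `ε`-optimal only if `u` is wrong in at most a quarter of the bits. As
there may be arbitrarily many rewards, all queries can be asked at once, and so near-optimal answers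
determine `θ` up to a Hamming ball of radius a quarter of the number of bits
(`TreeLayout.card_allEpsOptimal_le`), which contains an exponentially small part of all parameters
(`card_hammingBall_le`).

*A few episodes carry little information.* Compare the instance `θ` with the untilted instance. The
`χ²`-divergence of one episode is at most `e ^ 2`, even though the learner is adaptive, so the
second moment of the likelihood ratio of at most `K` episodes is at most `(1 + e ^ 2) ^ K`
(`tsum_stopped_le_pow`). Under the untilted instance the data do not depend on `θ`, so they are good
for a random `θ` with exponentially small probability. Hence for `K` of order `n * A * m / e ^ 2`
the probability of succeeding within `K` episodes is at most `1 / 4` on average over `θ`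
(`sum_tsum_good_le`). For some `θ` the algorithm therefore plays more than `K` episodes with
probability at least `1 / 4`, and the expected number of episodes is at least `(K + 1) / 4`, which
is of order `S ^ 2 * A * H ^ 2 / ε ^ 2`.
-/

namespace RewardFree

variable {S A H : ℕ}

/-! ### Trajectories of deterministic dynamics -/

/-- The trajectory `τ` starts in `s₀`, its actions are those prescribed by `d`, and its states
evolve by the deterministic stage-dependent dynamics `σ`. -/
def Follows (σ : Fin H → Fin S → Fin A → Fin S) (s₀ : Fin S) (d : DetPolicy S A H)
    (τ : Traj S A H) : Prop :=
  τ.1 0 = s₀ ∧ ∀ h, τ.2 h = d.act τ h ∧ τ.1 h.succ = σ h (τ.1 h.castSucc) (τ.2 h)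

theorem DetPolicy.act_congr {d : DetPolicy S A H} {τ τ' : Traj S A H} {h : Fin H}
    (h₁ : ∀ j : Fin (H + 1), j.val ≤ h.val → τ.1 j = τ'.1 j)
    (h₂ : ∀ j : Fin H, j.val < h.val → τ.2 j = τ'.2 j) : d.act τ h = d.act τ' h := by
  unfold DetPolicy.act
  congr 1
  · funext j
    exact h₁ _ (Nat.lt_succ_iff.mp j.isLt)
  · funext j
    exact h₂ _ j.isLt

theorem exists_follows [NeZero A] (σ : Fin H → Fin S → Fin A → Fin S) (s₀ : Fin S)
    (d : DetPolicy S A H) : ∃ τ, Follows σ s₀ d τ := by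
  have key : ∀ k, k ≤ H → ∃ τ : Traj S A H, τ.1 0 = s₀ ∧ ∀ h : Fin H, h.val < k →
      τ.2 h = d.act τ h ∧ τ.1 h.succ = σ h (τ.1 h.castSucc) (τ.2 h) := by
    intro k
    induction k with
    | zero => exact fun _ => ⟨(fun _ => s₀, fun _ => 0), rfl, fun h hh => by omega⟩
    | succ k ih =>
      intro hk
      obtain ⟨τ, h0, hτ⟩ := ih (by omega)
      let k' : Fin H := ⟨k, by omega⟩
      let τ' : Traj S A H :=
        (Function.update τ.1 k'.succ (σ k' (τ.1 k'.castSucc) (d.act τ k')),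
          Function.update τ.2 k' (d.act τ k'))
      have e1 : ∀ j : Fin (H + 1), j.val ≤ k → τ'.1 j = τ.1 j := by
        intro j hj
        apply Function.update_of_ne
        intro h
        have := congrArg Fin.val h
        simp [k'] at this
        omega
      have e2 : ∀ j : Fin H, j.val < k → τ'.2 j = τ.2 j := by
        intro j hj
        apply Function.update_of_ne
        intro h
        have := congrArg Fin.val h
        simp [k'] at this
        omega
      have e3 : ∀ h : Fin H, h.val ≤ k → d.act τ' h = d.act τ h := fun h hh =>
        DetPolicy.act_congr (fun j hj => e1 j (by omega)) (fun j hj => e2 j (by omega))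
      refine ⟨τ', (e1 0 (by simp)).trans h0, fun h hh => ?_⟩
      rcases Nat.lt_succ_iff_lt_or_eq.mp hh with hlt | heq
      · rw [e3 h hlt.le, e2 h hlt, e1 h.succ (by simp; omega), e1 h.castSucc (by simp; omega)]
        exact hτ h hlt
      · obtain rfl : h = k' := Fin.ext heq
        rw [e3 _ le_rfl, e1 k'.castSucc (by simp [k'])]
        simp [τ']
  obtain ⟨τ, h0, hτ⟩ := key H le_rfl
  exact ⟨τ, h0, fun h => hτ h h.isLt⟩

/-- Trajectories of two dynamics that agree before stage `k` agree up to stage `k`. -/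
theorem Follows.agree {σ σ' : Fin H → Fin S → Fin A → Fin S} {s₀ : Fin S} {d : DetPolicy S A H}
    {τ τ' : Traj S A H} (hτ : Follows σ s₀ d τ) (hτ' : Follows σ' s₀ d τ') (k : ℕ)
    (hσ : ∀ h : Fin H, h.val < k → σ h = σ' h) :
    (∀ j : Fin (H + 1), j.val ≤ k → τ.1 j = τ'.1 j) ∧
      ∀ j : Fin H, j.val ≤ k → τ.2 j = τ'.2 j := by
  have main : ∀ i ≤ k, (∀ j : Fin (H + 1), j.val ≤ i → τ.1 j = τ'.1 j) ∧
      ∀ j : Fin H, j.val < i → τ.2 j = τ'.2 j := by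
    intro i
    induction i with
    | zero =>
      refine fun _ => ⟨fun j hj => ?_, fun j hj => by omega⟩
      obtain rfl : j = 0 := Fin.ext (by simpa using hj)
      rw [hτ.1, hτ'.1]
    | succ i ih =>
      intro hi
      obtain ⟨ih1, ih2⟩ := ih (by omega)
      have hact : ∀ j : Fin H, j.val < i + 1 → τ.2 j = τ'.2 j := by
        intro j hj
        rw [(hτ.2 j).1, (hτ'.2 j).1]
        exact DetPolicy.act_congr (fun l hl => ih1 l (by omega)) (fun l hl => ih2 l (by omega))
      refine ⟨fun j hj => ?_, hact⟩
      rcases Nat.lt_or_ge j.val (i + 1) with h | h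
      · exact ih1 j (by omega)
      · have hij : j.val = i + 1 := by omega
        have hiH : i < H := by have := j.isLt; omega
        obtain rfl : j = (⟨i, hiH⟩ : Fin H).succ := Fin.ext hij
        rw [(hτ.2 _).2, (hτ'.2 _).2, hact _ (by simp), hσ _ (by simp; omega),
          ih1 _ (by simp)]
  obtain ⟨m1, m2⟩ := main k le_rfl
  refine ⟨m1, fun j hj => ?_⟩
  rw [(hτ.2 j).1, (hτ'.2 j).1]
  exact DetPolicy.act_congr (fun l hl => m1 l (by omega)) (fun l hl => m2 l (by omega))

theorem Follows.unique {σ : Fin H → Fin S → Fin A → Fin S} {s₀ : Fin S} {d : DetPolicy S A H}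
    {τ τ' : Traj S A H} (hτ : Follows σ s₀ d τ) (hτ' : Follows σ s₀ d τ') : τ = τ' := by
  obtain ⟨h1, h2⟩ := hτ.agree hτ' H fun _ _ => rfl
  exact Prod.ext (funext fun j => h1 j (by omega)) (funext fun j => h2 j (by omega))

/-! ### Tree-shaped decision processes -/

/-- The layout of a full binary tree on the state space. Nodes are numbered as in a heap: the root
is `1`, the children of `s` are `2 * s` and `2 * s + 1`, and the leaves are the states in
`[2 ^ depth, 2 ^ (depth + 1))`. Outcomes `o : O` are placed injectively on states outside the
tree. -/
structure TreeLayout (S H : ℕ) (O : Type) where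
  depth : ℕ
  depth_lt : depth < H
  two_pow_le : 2 ^ (depth + 1) ≤ S
  enc : O → Fin S
  enc_injective : Function.Injective enc
  enc_outside : ∀ o, (enc o).val = 0 ∨ 2 ^ (depth + 1) ≤ (enc o).val

namespace TreeLayout

variable {O : Type} (T : TreeLayout S H O)

/-- The stage at which a leaf is visited. -/
def leafStage : Fin H := ⟨T.depth, T.depth_lt⟩

theorem one_lt (T : TreeLayout S H O) : 1 < S := by
  have h := T.two_pow_le
  have : 1 ≤ 2 ^ T.depth := Nat.one_le_two_pow
  rw [pow_succ] at h
  omega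

/-- The root of the tree. -/
def root (T : TreeLayout S H O) : Fin S := ⟨1, T.one_lt⟩

/-- Leaves of the tree. -/
def IsLeaf (s : Fin S) : Prop := 2 ^ T.depth ≤ s.val ∧ s.val < 2 ^ (T.depth + 1)

instance (s : Fin S) : Decidable (T.IsLeaf s) := by unfold IsLeaf; infer_instance

/-- The deterministic motion away from the leaves: in an inner node, action `0` leads to the left
child and all other actions to the right child; the states outside the tree are absorbing. -/
def move (s : Fin S) (a : Fin A) : Fin S :=
  if h : 0 < s.val ∧ s.val < 2 ^ T.depth then
    ⟨2 * s.val + if a.val = 0 then 0 else 1, by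
      have := T.two_pow_le
      rw [pow_succ] at this
      split_ifs <;> omega⟩
  else s

/-- The stage-invariant decision process in which the tree is traversed deterministically from the
root, and playing `a` in the leaf `s` yields an outcome with law `κ s a`, in whose state the rest of
the episode is spent. -/
noncomputable def mdp (A : ℕ) (κ : Fin S → Fin A → PMF O) : MDP S A H where
  init := PMF.pure T.root
  trans _ s a := if T.IsLeaf s then (κ s a).map T.enc else PMF.pure (T.move s a)

theorem mdp_stageInvariant (κ : Fin S → Fin A → PMF O) : (T.mdp A κ).StageInvariant :=
  fun _ _ => rfl

/-- The dynamics of the tree when the outcome is forced to be `o`. -/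
def step (o : O) (h : Fin H) (s : Fin S) (a : Fin A) : Fin S :=
  if h = T.leafStage then T.enc o else T.move s a

theorem move_enc (o : O) (a : Fin A) : T.move (T.enc o) a = T.enc o := by
  have h2 : 2 ^ (T.depth + 1) = 2 ^ T.depth * 2 := pow_succ _ _
  rcases T.enc_outside o with h | h
  · rw [move, dif_neg (by omega)]
  · rw [move, dif_neg (by omega)]

theorem not_isLeaf_enc (o : O) : ¬ T.IsLeaf (T.enc o) := by
  have h2 : 0 < 2 ^ T.depth := by positivity
  unfold IsLeaf
  rcases T.enc_outside o with h | h <;> omega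

/-- As long as a leaf has not been left, the state at stage `h` lies in level `h` of the tree. -/
theorem level_of_move {τ : Traj S A H} (h0 : τ.1 0 = T.root)
    (hτ : ∀ h : Fin H, h.val < T.depth → T.IsLeaf (τ.1 h.castSucc) ∨
      τ.1 h.succ = T.move (τ.1 h.castSucc) (τ.2 h)) :
    ∀ j : Fin (H + 1), j.val ≤ T.depth → 2 ^ j.val ≤ (τ.1 j).val ∧
      (τ.1 j).val < 2 ^ (j.val + 1) := by
  rintro ⟨j, hj⟩ hjd
  induction j with
  | zero =>
    have : (⟨0, hj⟩ : Fin (H + 1)) = 0 := rfl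
    rw [this, h0]
    simp [root]
  | succ j ih =>
    have hjd' : j + 1 ≤ T.depth := hjd
    have ih' := ih (by omega) (by simp; omega)
    have hlt : 2 ^ (j + 1) ≤ 2 ^ T.depth := Nat.pow_le_pow_right (by norm_num) hjd'
    have hpos : 0 < 2 ^ j := by positivity
    have hH : j < H := by omega
    simp only at ih' ⊢
    have hnl : ¬ T.IsLeaf (τ.1 (⟨j, hH⟩ : Fin H).castSucc) := by
      unfold IsLeaf
      simp only [Fin.castSucc_mk]
      omega
    have hs := (hτ ⟨j, hH⟩ (by simp; omega)).resolve_left hnl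
    simp only [Fin.succ_mk, Fin.castSucc_mk] at hs
    rw [hs, move, dif_pos (by omega)]
    simp only [pow_succ] at ih' ⊢
    split_ifs <;> omega

variable [NeZero A]

/-- The trajectory of `d` in the tree when the outcome is `o`. -/
noncomputable def run (d : DetPolicy S A H) (o : O) : Traj S A H :=
  (exists_follows (T.step o) T.root d).choose

theorem run_follows (d : DetPolicy S A H) (o : O) : Follows (T.step o) T.root d (T.run d o) :=
  (exists_follows (T.step o) T.root d).choose_spec

theorem run_level (d : DetPolicy S A H) (o : O) (j : Fin (H + 1)) (hj : j.val ≤ T.depth) :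
    2 ^ j.val ≤ ((T.run d o).1 j).val ∧ ((T.run d o).1 j).val < 2 ^ (j.val + 1) := by
  refine T.level_of_move (T.run_follows d o).1 (fun h hh => Or.inr ?_) j hj
  rw [((T.run_follows d o).2 h).2, step, if_neg]
  rintro rfl
  exact lt_irrefl _ hh

theorem run_outcome (d : DetPolicy S A H) (o : O) (j : Fin (H + 1)) (hj : T.depth < j.val) :
    (T.run d o).1 j = T.enc o := by
  obtain ⟨j, hjH⟩ := j
  simp only at hj
  induction j with
  | zero => omega
  | succ j ih =>
    have hs := ((T.run_follows d o).2 ⟨j, by omega⟩).2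
    simp only [Fin.succ_mk, Fin.castSucc_mk] at hs
    rw [hs, step]
    split_ifs with h
    · rfl
    · have : T.depth ≠ j := fun h' => h (Fin.ext h'.symm)
      rw [ih (by omega) (by omega), move_enc]

theorem run_injective (d : DetPolicy S A H) : Function.Injective (T.run d) := by
  intro o o' h
  apply T.enc_injective
  rw [← T.run_outcome d o (Fin.last H) T.depth_lt, h, T.run_outcome d o' _ T.depth_lt]

/-- Sums over trajectories reduce to sums over outcomes. -/
theorem sum_traj_eq_sum_outcome [Fintype O] {M : Type*} [AddCommMonoid M] (d : DetPolicy S A H)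
    (f : Traj S A H → M) (hf : ∀ τ, (∀ o, τ ≠ T.run d o) → f τ = 0) :
    ∑ τ, f τ = ∑ o, f (T.run d o) := by
  classical
  rw [← Finset.sum_image (s := Finset.univ) (g := T.run d) (f := f)
    fun _ _ _ _ h => T.run_injective d h]
  refine (Finset.sum_subset (Finset.subset_univ _) fun τ _ hτ => hf τ fun o ho => hτ ?_).symm
  exact Finset.mem_image.mpr ⟨o, Finset.mem_univ _, ho.symm⟩

theorem run_agree (d : DetPolicy S A H) (o o' : O) :
    (∀ j : Fin (H + 1), j.val ≤ T.depth → (T.run d o).1 j = (T.run d o').1 j) ∧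
      ∀ j : Fin H, j.val ≤ T.depth → (T.run d o).2 j = (T.run d o').2 j := by
  refine (T.run_follows d o).agree (T.run_follows d o') T.depth fun h hh => ?_
  have : h ≠ T.leafStage := by
    rintro rfl
    exact lt_irrefl _ hh
  funext s a
  simp [step, this]

theorem exists_run_of_trajProb_ne_zero (κ : Fin S → Fin A → PMF O) (d : DetPolicy S A H)
    (τ : Traj S A H) (h : trajProb (T.mdp A κ) d τ ≠ 0) : ∃ o, τ = T.run d o := by
  unfold trajProb at h
  obtain ⟨h0, hp⟩ := mul_ne_zero_iff.mp h
  rw [Finset.prod_ne_zero_iff] at hp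
  have hroot : τ.1 0 = T.root := by
    by_contra hne
    exact h0 (by simp [mdp, PMF.pure_apply, hne])
  have hact : ∀ h, τ.2 h = d.act τ h := by
    intro h
    by_contra hne
    exact hp h (Finset.mem_univ _) (if_neg hne)
  have htr : ∀ h, (T.mdp A κ).trans h (τ.1 h.castSucc) (τ.2 h) (τ.1 h.succ) ≠ 0 := by
    intro h
    have := hp h (Finset.mem_univ _)
    rwa [if_pos (hact h)] at this
  have hmove : ∀ h : Fin H, ¬ T.IsLeaf (τ.1 h.castSucc) →
      τ.1 h.succ = T.move (τ.1 h.castSucc) (τ.2 h) := by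
    intro h hnl
    by_contra hne
    exact htr h (by simp [mdp, hnl, PMF.pure_apply, hne])
  have hlevel := T.level_of_move (τ := τ) hroot fun h _ => or_iff_not_imp_left.mpr (hmove h)
  have hleaf : T.IsLeaf (τ.1 T.leafStage.castSucc) := hlevel T.leafStage.castSucc le_rfl
  have hout := htr T.leafStage
  simp only [mdp, if_pos hleaf] at hout
  obtain ⟨o, -, ho⟩ := (PMF.mem_support_map_iff _ _ _).mp ((PMF.mem_support_iff _ _).mpr hout)
  have hafter : ∀ (j : ℕ) (hj : j < H + 1), T.depth < j → τ.1 ⟨j, hj⟩ = T.enc o := by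
    intro j
    induction j with
    | zero => intro _ h; omega
    | succ j ih =>
      intro hj hdj
      rcases Nat.lt_or_ge T.depth j with hlt | hge
      · have hm := hmove ⟨j, by omega⟩
        simp only [Fin.succ_mk, Fin.castSucc_mk] at hm
        rw [ih (by omega) hlt] at hm
        rw [hm (T.not_isLeaf_enc o), move_enc]
      · obtain rfl : j = T.depth := by omega
        exact ho.symm
  refine ⟨o, Follows.unique (σ := T.step o) ⟨hroot, fun h => ⟨hact h, ?_⟩⟩ (T.run_follows d o)⟩
  unfold step
  split_ifs with hh
  · subst hh
    exact ho.symm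
  · apply hmove
    rcases lt_or_ge T.depth h.val with hlt | hge
    · have := hafter h.val (by omega) hlt
      rw [show h.castSucc = ⟨h.val, by omega⟩ from rfl, this]
      exact T.not_isLeaf_enc o
    · have hlt : h.val < T.depth := lt_of_le_of_ne hge fun h' => hh (Fin.ext h')
      have hl := (hlevel h.castSucc hge).2
      have : 2 ^ (h.val + 1) ≤ 2 ^ T.depth := Nat.pow_le_pow_right (by norm_num) hlt
      simp only [Fin.val_castSucc] at hl
      unfold IsLeaf
      omega

theorem trajProb_eq_zero (κ : Fin S → Fin A → PMF O) (d : DetPolicy S A H)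
    (τ : Traj S A H) (h : ∀ o, τ ≠ T.run d o) : trajProb (T.mdp A κ) d τ = 0 := by
  by_contra hne
  obtain ⟨o, ho⟩ := T.exists_run_of_trajProb_ne_zero κ d τ hne
  exact h o ho

variable [Inhabited O]

/-- The leaf to which `d` leads. It does not depend on the outcome, see `run_leaf`. -/
noncomputable def leafOf (d : DetPolicy S A H) : Fin S := (T.run d default).1 T.leafStage.castSucc

/-- The action that `d` plays in the leaf. It does not depend on the outcome, see `run_act`. -/
noncomputable def actOf (d : DetPolicy S A H) : Fin A := (T.run d default).2 T.leafStage

theorem run_leaf (d : DetPolicy S A H) (o : O) :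
    (T.run d o).1 T.leafStage.castSucc = T.leafOf d :=
  (T.run_agree d o default).1 _ le_rfl

theorem run_act (d : DetPolicy S A H) (o : O) : (T.run d o).2 T.leafStage = T.actOf d :=
  (T.run_agree d o default).2 _ le_rfl

theorem isLeaf_leafOf (d : DetPolicy S A H) : T.IsLeaf (T.leafOf d) :=
  T.run_level d default T.leafStage.castSucc le_rfl

/-- The episode reduces to a single pull of the arm `(leafOf d, actOf d)`. -/
theorem trajProb_run (κ : Fin S → Fin A → PMF O) (d : DetPolicy S A H) (o : O) :
    trajProb (T.mdp A κ) d (T.run d o) = κ (T.leafOf d) (T.actOf d) o := by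
  classical
  have hf := T.run_follows d o
  unfold trajProb
  rw [hf.1, Finset.prod_eq_single T.leafStage]
  · rw [if_pos (hf.2 _).1, T.run_leaf, T.run_act, T.run_outcome d o _ (by simp [leafStage])]
    simp only [mdp, if_pos (T.isLeaf_leafOf d), PMF.pure_apply, if_true, one_mul]
    rw [PMF.map_apply, tsum_eq_single o]
    · simp
    · intro o' ho'
      rw [if_neg fun h => ho' (T.enc_injective h).symm]
  · intro h _ hne
    rw [if_pos (hf.2 h).1]
    have hnl : ¬ T.IsLeaf ((T.run d o).1 h.castSucc) := by
      rcases lt_or_ge T.depth h.val with hlt | hge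
      · rw [T.run_outcome d o _ hlt]
        exact T.not_isLeaf_enc o
      · have hlt : h.val < T.depth := lt_of_le_of_ne hge fun h' => hne (Fin.ext h')
        have hl := (T.run_level d o h.castSucc hge).2
        have : 2 ^ (h.val + 1) ≤ 2 ^ T.depth := Nat.pow_le_pow_right (by norm_num) hlt
        simp only [Fin.val_castSucc] at hl
        unfold IsLeaf
        omega
    simp only [mdp, if_neg hnl, PMF.pure_apply]
    rw [(hf.2 h).2, step, if_neg hne, if_pos rfl]
  · simp

/-- Every arm is played by some decision rule: the binary digits of the number of a leaf, without
the leading one, describe the path from the root to that leaf. -/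
theorem exists_detPolicy (hA : 2 ≤ A) (s : Fin S) (hs : T.IsLeaf s) (a : Fin A) :
    ∃ d : DetPolicy S A H, T.leafOf d = s ∧ T.actOf d = a := by
  let d : DetPolicy S A H := fun h _ _ =>
    if h.val = T.depth then a else ⟨s.val / 2 ^ (T.depth - h.val - 1) % 2, by omega⟩
  refine ⟨d, ?_, ?_⟩
  · have hf := T.run_follows d default
    have key : ∀ (j : ℕ) (hj : j < H + 1), j ≤ T.depth →
        ((T.run d default).1 ⟨j, hj⟩).val = s.val / 2 ^ (T.depth - j) := by
      intro j
      induction j with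
      | zero =>
        intro _ _
        have : (T.run d default).1 ⟨0, by omega⟩ = T.root := hf.1
        rw [this]
        obtain ⟨h1, h2⟩ := hs
        have : s.val / 2 ^ T.depth = 1 := by
          rw [Nat.div_eq_iff (by positivity)]
          rw [pow_succ] at h2
          omega
        simp [root, this]
      | succ j ih =>
        intro hj hjd
        have ih' := ih (by omega) (by omega)
        have hlev := T.run_level d default ⟨j, by omega⟩ (by simp; omega)
        have hst := hf.2 ⟨j, by omega⟩
        simp only [Fin.succ_mk, Fin.castSucc_mk] at hst
        have hne : (⟨j, by omega⟩ : Fin H) ≠ T.leafStage := fun h => by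
          have : j = T.depth := congrArg Fin.val h
          omega
        have hpow : 2 ^ (j + 1) ≤ 2 ^ T.depth := Nat.pow_le_pow_right (by norm_num) hjd
        have hpos : 0 < 2 ^ j := by positivity
        simp only at hlev
        rw [hst.2, step, if_neg hne, move, dif_pos (by omega), hst.1]
        have hdiv : s.val / 2 ^ (T.depth - j) = s.val / 2 ^ (T.depth - (j + 1)) / 2 := by
          rw [Nat.div_div_eq_div_mul, ← pow_succ]
          congr 2
          omega
        have hjne : j ≠ T.depth := by omega
        have hact : (d.act (T.run d default) ⟨j, by omega⟩).val =
            s.val / 2 ^ (T.depth - (j + 1)) % 2 := congrArg Fin.val (if_neg hjne)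
        simp only [hact, ih', hdiv]
        split_ifs <;> omega
    apply Fin.ext
    rw [leafOf]
    have := key T.depth (by have := T.depth_lt; omega) le_rfl
    rwa [Nat.sub_self, pow_zero, Nat.div_one] at this
  · rw [actOf, ((T.run_follows d default).2 _).1]
    simp [DetPolicy.act, d, leafStage]

end TreeLayout

/-! ### Sequential sampling with adaptive stopping -/

section PathWeight

variable {α δ : Type*}

/-- The product of the weights `w d a` along a sequence of observations, where the decision `d`
before each observation is made by the rule `e` from the observations so far; it vanishes if `e`
stops before the end of the sequence. For `w d` a probability mass function this is the law of the
observations. -/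
noncomputable def pathWeight (e : List α → Option δ) (w : δ → α → ℝ≥0∞) (D : List α) : ℝ≥0∞ :=
  ∏ k : Fin D.length,
    match e (D.take k.val) with
    | none => 0
    | some d => w d (D.get k)

theorem pathWeight_nil (e : List α → Option δ) (w : δ → α → ℝ≥0∞) : pathWeight e w [] = 1 := by
  simp [pathWeight]

theorem pathWeight_cons_of_none {e : List α → Option δ} (w : δ → α → ℝ≥0∞) (h : e [] = none)
    (a : α) (D : List α) : pathWeight e w (a :: D) = 0 := by
  unfold pathWeight
  exact Finset.prod_eq_zero (Finset.mem_univ (⟨0, by simp⟩ : Fin (a :: D).length)) (by simp [h])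

theorem pathWeight_cons_of_some {e : List α → Option δ} (w : δ → α → ℝ≥0∞) {d : δ}
    (h : e [] = some d) (a : α) (D : List α) :
    pathWeight e w (a :: D) = w d a * pathWeight (fun D' => e (a :: D')) w D := by
  unfold pathWeight
  rw [show (∏ k : Fin (a :: D).length, _) = ∏ k : Fin (D.length + 1), _ from rfl,
    Fin.prod_univ_succ]
  simp [h]

theorem tsum_list_eq (f : List α → ℝ≥0∞) :
    ∑' D, f D = f [] + ∑' a, ∑' D, f (a :: D) := by
  let φ : Unit ⊕ (α × List α) ≃ List α :=
    { toFun := Sum.elim (fun _ => []) fun p => p.1 :: p.2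
      invFun := fun D => match D with
        | [] => Sum.inl ()
        | a :: D => Sum.inr (a, D)
      left_inv := by rintro (_ | ⟨a, D⟩) <;> rfl
      right_inv := by rintro (_ | ⟨a, D⟩) <;> rfl }
  rw [← φ.tsum_eq, Summable.tsum_sum ENNReal.summable ENNReal.summable, tsum_fintype,
    Fintype.sum_unique, ENNReal.tsum_prod']
  rfl

open Classical in
/-- The total weight of the sequences at which the rule stops within `K` observations. -/
theorem tsum_stopped_le_pow {w : δ → α → ℝ≥0∞} {B : ℝ≥0∞} (hB : 1 ≤ B)
    (hw : ∀ d, ∑' a, w d a ≤ B) (K : ℕ) (e : List α → Option δ) :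
    ∑' D, (if D.length ≤ K ∧ e D = none then pathWeight e w D else 0) ≤ B ^ K := by
  induction K generalizing e with
  | zero =>
    rw [tsum_list_eq]
    simp only [List.length_cons, Nat.le_zero, Nat.add_eq_zero_iff, one_ne_zero, and_false,
      false_and, if_false, tsum_zero, add_zero, pow_zero, pathWeight_nil]
    split_ifs <;> simp
  | succ K ih =>
    rw [tsum_list_eq]
    rcases he : e [] with _ | d
    · simp only [pathWeight_cons_of_none w he, ite_self, tsum_zero, add_zero, pathWeight_nil]
      split_ifs
      · exact one_le_pow₀ hB
      · simp
    · rw [if_neg (by simp), zero_add]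
      calc ∑' a, ∑' D, (if (a :: D).length ≤ K + 1 ∧ e (a :: D) = none
              then pathWeight e w (a :: D) else 0)
          = ∑' a, w d a * ∑' D, (if D.length ≤ K ∧ e (a :: D) = none
              then pathWeight (fun D' => e (a :: D')) w D else 0) := by
            refine tsum_congr fun a => ?_
            rw [← ENNReal.tsum_mul_left]
            refine tsum_congr fun D => ?_
            rw [pathWeight_cons_of_some w he]
            simp only [List.length_cons, Nat.add_le_add_iff_right, mul_ite, mul_zero]
        _ ≤ ∑' a, w d a * B ^ K :=
            ENNReal.tsum_le_tsum fun a => mul_le_mul_right (ih fun D' => e (a :: D')) _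
        _ ≤ B * B ^ K := by
            rw [ENNReal.tsum_mul_right]
            exact mul_le_mul_left (hw d) _
        _ = B ^ (K + 1) := (pow_succ' B K).symm

open Classical in
theorem tsum_stopped_le_one {w : δ → α → ℝ≥0∞} (hw : ∀ d, ∑' a, w d a ≤ 1)
    (e : List α → Option δ) :
    ∑' D, (if e D = none then pathWeight e w D else 0) ≤ 1 := by
  rw [ENNReal.tsum_eq_iSup_sum]
  refine iSup_le fun s => ?_
  calc ∑ D ∈ s, (if e D = none then pathWeight e w D else 0)
      = ∑ D ∈ s, (if D.length ≤ s.sup List.length ∧ e D = none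
          then pathWeight e w D else 0) := by
        refine Finset.sum_congr rfl fun D hD => ?_
        simp [Finset.le_sup (f := List.length) hD]
    _ ≤ _ := ENNReal.sum_le_tsum s
    _ ≤ 1 ^ s.sup List.length := tsum_stopped_le_pow le_rfl hw _ e
    _ = 1 := one_pow _

open Classical in
/-- A run that stops after more than `j` observations has not stopped after `j` observations. -/
theorem tsum_stopped_late_le {w : δ → α → ℝ≥0∞} (hw : ∀ d, ∑' a, w d a ≤ 1) (j : ℕ)
    (e : List α → Option δ) :
    ∑' D, (if j < D.length ∧ e D = none then pathWeight e w D else 0) ≤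
      ∑' D, (if D.length = j ∧ e D ≠ none then pathWeight e w D else 0) := by
  induction j generalizing e with
  | zero =>
    rw [tsum_list_eq, tsum_list_eq fun D => ite (D.length = 0 ∧ e D ≠ none) _ _]
    rcases he : e [] with _ | d
    · simp [pathWeight_cons_of_none w he]
    · simp only [List.length_nil, lt_irrefl, false_and, if_false, zero_add, List.length_cons,
        Nat.zero_lt_succ, true_and, pathWeight_cons_of_some w he, Nat.add_eq_zero_iff,
        one_ne_zero, and_false, tsum_zero, add_zero, pathWeight_nil, ne_eq, reduceCtorEq,
        not_false_eq_true, and_self, if_true]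
      calc _ ≤ ∑' a, w d a * 1 := by
            refine ENNReal.tsum_le_tsum fun a => ?_
            refine le_trans (le_of_eq ?_)
              (mul_le_mul_right (tsum_stopped_le_one hw fun D' => e (a :: D')) _)
            rw [← ENNReal.tsum_mul_left]
            simp only [mul_ite, mul_zero]
        _ ≤ 1 := by simpa using hw d
  | succ j ih =>
    rw [tsum_list_eq, tsum_list_eq fun D => ite (D.length = j + 1 ∧ e D ≠ none) _ _]
    rcases he : e [] with _ | d
    · simp [pathWeight_cons_of_none w he]
    · simp only [List.length_nil, Nat.not_lt_zero, false_and, if_false, zero_add,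
        List.length_cons, Nat.add_lt_add_iff_right, pathWeight_cons_of_some w he,
        Nat.add_right_cancel_iff, (Nat.succ_ne_zero j).symm]
      refine ENNReal.tsum_le_tsum fun a => ?_
      have := mul_le_mul_right (ih fun D' => e (a :: D')) (w d a)
      simpa only [← ENNReal.tsum_mul_left, mul_ite, mul_zero] using this

theorem pathWeight_ne_top {w : δ → α → ℝ≥0∞} (hw : ∀ d a, w d a ≠ ∞) (e : List α → Option δ)
    (D : List α) : pathWeight e w D ≠ ∞ := by
  unfold pathWeight
  refine ENNReal.prod_ne_top fun k _ => ?_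
  cases e (D.take k.val) with
  | none => simp
  | some d => exact hw _ _

/-- Change of measure, with `w₂ = w² / w₀` the integrand of the `χ²`-divergence: the likelihood
ratio `w / w₀` is at most `L + L⁻¹ (w / w₀)²`. -/
theorem pathWeight_le_add {w w₀ w₂ : δ → α → ℝ≥0∞} (hw : ∀ d a, w d a ≠ ∞)
    (h : ∀ d a, w d a * w d a = w₂ d a * w₀ d a) {L : ℝ≥0∞} (hL : L ≠ 0) (hL' : L ≠ ∞)
    (e : List α → Option δ) (D : List α) :
    pathWeight e w D ≤ L * pathWeight e w₀ D + L⁻¹ * pathWeight e w₂ D := by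
  have hmul : pathWeight e w D * pathWeight e w D = pathWeight e w₂ D * pathWeight e w₀ D := by
    unfold pathWeight
    rw [← Finset.prod_mul_distrib, ← Finset.prod_mul_distrib]
    refine Finset.prod_congr rfl fun k _ => ?_
    cases e (D.take k.val) with
    | none => simp
    | some d => exact h _ _
  set p := pathWeight e w D with hp
  rcases le_total p (L * pathWeight e w₀ D) with hle | hge
  · exact hle.trans le_self_add
  · refine le_trans ?_ le_add_self
    rcases eq_or_ne p 0 with h0 | h0
    · simp [h0]
    · have hinv : pathWeight e w₀ D ≤ L⁻¹ * p := by
        rwa [← ENNReal.div_eq_inv_mul, ENNReal.le_div_iff_mul_le (Or.inl hL) (Or.inl hL'), mul_comm]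
      have : p * p ≤ (L⁻¹ * pathWeight e w₂ D) * p := by
        rw [hmul]
        calc _ ≤ pathWeight e w₂ D * (L⁻¹ * p) := mul_le_mul_right hinv _
          _ = _ := by ring
      exact (ENNReal.mul_le_mul_iff_left h0 (pathWeight_ne_top hw e D)).mp this

open Classical in
/-- If every data set is good for at most `G` of the parameters `θ`, then the probability of
stopping within `K` observations with a data set that is good for the true parameter is small on
average over `θ`. Here `w₀` is a reference model with respect to which the `χ²`-divergence of a
single observation is at most `B - 1`. -/
theorem sum_tsum_good_le {Θ : Type*} [Fintype Θ] {w w₂ : Θ → δ → α → ℝ≥0∞} {w₀ : δ → α → ℝ≥0∞}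
    (hw : ∀ θ d a, w θ d a ≠ ∞) (h : ∀ θ d a, w θ d a * w θ d a = w₂ θ d a * w₀ d a)
    (hw₀ : ∀ d, ∑' a, w₀ d a ≤ 1) {B : ℝ≥0∞} (hB : 1 ≤ B) (hw₂ : ∀ θ d, ∑' a, w₂ θ d a ≤ B)
    (e : List α → Option δ) (good : Θ → List α → Prop) {G : ℝ≥0∞}
    (hG : ∀ D, (Finset.univ.filter fun θ => good θ D).card ≤ G) {L : ℝ≥0∞} (hL : L ≠ 0)
    (hL' : L ≠ ∞) (K : ℕ) :
    ∑ θ, ∑' D, (if D.length ≤ K ∧ e D = none ∧ good θ D then pathWeight e (w θ) D else 0) ≤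
      L * G + Fintype.card Θ * (L⁻¹ * B ^ K) := by
  calc _ ≤ ∑ θ, (∑' D, (if e D = none ∧ good θ D then L * pathWeight e w₀ D else 0) +
        ∑' D, L⁻¹ * (if D.length ≤ K ∧ e D = none then pathWeight e (w₂ θ) D else 0)) := by
        refine Finset.sum_le_sum fun θ _ => ?_
        rw [← ENNReal.tsum_add]
        refine ENNReal.tsum_le_tsum fun D => ?_
        by_cases hD : D.length ≤ K ∧ e D = none ∧ good θ D
        · rw [if_pos hD, if_pos hD.2, if_pos ⟨hD.1, hD.2.1⟩]
          exact pathWeight_le_add (hw θ) (h θ) hL hL' e D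
        · rw [if_neg hD]
          exact zero_le
    _ ≤ _ := by
        rw [Finset.sum_add_distrib]
        refine add_le_add ?_ ?_
        · rw [← Summable.tsum_finsetSum fun _ _ => ENNReal.summable]
          calc _ = ∑' D, L * ((Finset.univ.filter fun θ => good θ D).card *
                (if e D = none then pathWeight e w₀ D else 0)) := by
                refine tsum_congr fun D => ?_
                by_cases he : e D = none
                · simp only [he, true_and, if_true, ← Finset.sum_filter, Finset.sum_const,
                    nsmul_eq_mul]
                  ring
                · simp [he]
            _ ≤ ∑' D, L * (G * (if e D = none then pathWeight e w₀ D else 0)) := by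
                refine ENNReal.tsum_le_tsum fun D => ?_
                gcongr
                exact hG D
            _ = L * (G * ∑' D, (if e D = none then pathWeight e w₀ D else 0)) := by
                rw [ENNReal.tsum_mul_left, ENNReal.tsum_mul_left]
            _ ≤ L * (G * 1) := by
                gcongr
                exact tsum_stopped_le_one hw₀ e
            _ = L * G := by rw [mul_one]
        · calc _ ≤ ∑ _θ : Θ, L⁻¹ * B ^ K := by
                refine Finset.sum_le_sum fun θ _ => ?_
                rw [ENNReal.tsum_mul_left]
                gcongr
                exact tsum_stopped_le_pow hB (hw₂ θ) K e
            _ = _ := by simp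

end PathWeight

/-! ### Lower bounds on the number of episodes -/

/-- The policies `π i` are simultaneously `ε`-optimal for the rewards `r i`. -/
def AllEpsOptimal {N : ℕ} (M : MDP S A H) (r : Fin N → Reward S A H) (ε : ℝ)
    (π : Fin N → Policy S A H) : Prop :=
  ∀ i, IsEpsOptimal M (r i) ε (π i)

namespace Algorithm

variable (alg : Algorithm S A H)

theorem dataProb_eq_pathWeight (M : MDP S A H) (ω : alg.Seed) (D : List (Traj S A H)) :
    alg.dataProb M ω D = pathWeight (alg.explore ω) (trajProb M) D := by
  unfold dataProb pathWeight
  refine Finset.prod_congr rfl fun k _ => ?_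
  cases alg.explore ω (D.take k.val) <;> rfl

theorem measurable_comp_explore (D : List (Traj S A H)) (g : Option (DetPolicy S A H) → ℝ≥0∞) :
    Measurable fun ω => g (alg.explore ω D) := by
  let _ : MeasurableSpace (Option (DetPolicy S A H)) := ⊤
  exact (measurable_from_top (f := g)).comp
    (measurable_to_countable' fun o => alg.measurable_explore D o)

theorem measurable_dataProb (M : MDP S A H) (D : List (Traj S A H)) :
    Measurable fun ω => alg.dataProb M ω D := by
  unfold dataProb
  refine Finset.measurable_fun_prod _ fun k _ => ?_
  exact alg.measurable_comp_explore (D.take k.val) fun o =>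
    match o with
    | none => 0
    | some d => trajProb M d (D.get k)

open Classical in
theorem measurable_tsum_continue (M : MDP S A H) (k : ℕ) :
    Measurable fun ω => ∑' D : List (Traj S A H),
      (if D.length = k ∧ alg.explore ω D ≠ none then alg.dataProb M ω D else 0) := by
  refine Measurable.tsum fun D => Measurable.ite ?_ (alg.measurable_dataProb M D)
    measurable_const
  by_cases hD : D.length = k
  · simp only [hD, true_and]
    exact (alg.measurable_explore D none).compl
  · simp [hD]

open Classical in
/-- The probability of success is at most the probability of success within `K` episodes plus the
probability of playing more than `j ≤ K` episodes. -/
theorem successProb_le_add {M : MDP S A H} (hM : ∀ d, ∑' τ, trajProb M d τ ≤ 1) (ε : ℝ) (N : ℕ)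
    (r : Fin N → Reward S A H) {j K : ℕ} (hj : j ≤ K) :
    alg.successProb M ε N r ≤
      (∫⁻ ω, ∑' D : List (Traj S A H), (if D.length ≤ K ∧ alg.explore ω D = none ∧
        AllEpsOptimal M r ε (alg.plan ω D N r)
          then pathWeight (alg.explore ω) (trajProb M) D else 0) ∂alg.seedLaw) +
        alg.probMoreThan M j := by
  unfold successProb probMoreThan
  rw [← lintegral_add_right _ (alg.measurable_tsum_continue M j)]
  refine lintegral_mono fun ω => ?_
  have hlate := tsum_stopped_late_le hM j (alg.explore ω)
  simp only [dataProb_eq_pathWeight]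
  refine le_trans ?_ (add_le_add_right hlate _)
  rw [← ENNReal.tsum_add]
  refine ENNReal.tsum_le_tsum fun D => ?_
  by_cases h : alg.explore ω D = none ∧ ∀ i, IsEpsOptimal M (r i) ε (alg.plan ω D N r i)
  · rw [if_pos h]
    rcases le_or_gt D.length K with hK | hK
    · rw [if_pos ⟨hK, h⟩]
      exact le_self_add
    · rw [if_pos (c := j < D.length ∧ _) ⟨hj.trans_lt hK, h.1⟩]
      exact le_add_self
  · rw [if_neg h]
    exact zero_le

open Classical in
/-- Lower bound on the number of episodes for a finite family of decision processes. Since `G`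
bounds the number of processes for which a given collection of policies is simultaneously
`ε`-optimal, an algorithm with few episodes would have to distinguish the processes with less
information than `χ²`-divergences allow. -/
theorem exists_le_expectedEpisodes {Θ : Type*} [Fintype Θ] [Nonempty Θ] {M : Θ → MDP S A H}
    {M₀ : MDP S A H} {w₂ : Θ → DetPolicy S A H → Traj S A H → ℝ≥0∞}
    (hM : ∀ θ d, ∑' τ, trajProb (M θ) d τ ≤ 1) (hM₀ : ∀ d, ∑' τ, trajProb M₀ d τ ≤ 1)
    (h : ∀ θ d τ, trajProb (M θ) d τ * trajProb (M θ) d τ = w₂ θ d τ * trajProb M₀ d τ)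
    {B : ℝ≥0∞} (hB : 1 ≤ B) (hw₂ : ∀ θ d, ∑' τ, w₂ θ d τ ≤ B)
    {ε : ℝ} {N : ℕ} (r : Fin N → Reward S A H) {G : ℝ≥0∞}
    (hG : ∀ π : Fin N → Policy S A H,
      (Finset.univ.filter fun θ => AllEpsOptimal (M θ) r ε π).card ≤ G)
    {L : ℝ≥0∞} (hL : L ≠ 0) (hL' : L ≠ ∞) (K : ℕ)
    (hsmall : L * G + Fintype.card Θ * (L⁻¹ * B ^ K) ≤ Fintype.card Θ * 4⁻¹)
    (hsucc : ∀ θ, 2⁻¹ ≤ alg.successProb (M θ) ε N r) :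
    ∃ θ, ((K + 1 : ℕ) : ℝ≥0∞) * 4⁻¹ ≤ alg.expectedEpisodes (M θ) := by
  set early : Θ → ℝ≥0∞ := fun θ => ∫⁻ ω, ∑' D : List (Traj S A H),
    (if D.length ≤ K ∧ alg.explore ω D = none ∧
      AllEpsOptimal (M θ) r ε (alg.plan ω D N r)
        then pathWeight (alg.explore ω) (trajProb (M θ)) D else 0) ∂alg.seedLaw with hearly
  have hfin : ∀ θ d τ, trajProb (M θ) d τ ≠ ∞ := fun θ d τ =>
    ne_top_of_le_ne_top ENNReal.one_ne_top ((ENNReal.le_tsum τ).trans (hM θ d))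
  have hsum : ∑ θ, early θ ≤ ∑ _θ : Θ, 4⁻¹ := by
    calc ∑ θ, early θ ≤ ∫⁻ ω, ∑ θ, ∑' D : List (Traj S A H),
          (if D.length ≤ K ∧ alg.explore ω D = none ∧
            AllEpsOptimal (M θ) r ε (alg.plan ω D N r)
              then pathWeight (alg.explore ω) (trajProb (M θ)) D else 0) ∂alg.seedLaw := by
          -- superadditivity of the lower integral needs no measurability of the planner
          have key : ∀ (s : Finset Θ) (f : Θ → alg.Seed → ℝ≥0∞),
              ∑ θ ∈ s, ∫⁻ ω, f θ ω ∂alg.seedLaw ≤ ∫⁻ ω, ∑ θ ∈ s, f θ ω ∂alg.seedLaw := by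
            intro s f
            induction s using Finset.induction_on with
            | empty => simp
            | insert a s ha ih =>
              simp only [Finset.sum_insert ha]
              exact (add_le_add_right ih _).trans (le_lintegral_add _ _)
          exact key _ _
      _ ≤ ∫⁻ _ω, Fintype.card Θ * 4⁻¹ ∂alg.seedLaw := by
          refine lintegral_mono fun ω => ?_
          exact (sum_tsum_good_le hfin h hM₀ hB hw₂ (alg.explore ω)
            (fun θ D => AllEpsOptimal (M θ) r ε (alg.plan ω D N r))
            (fun D => hG (alg.plan ω D N r)) hL hL' K).trans hsmall
      _ = ∑ _θ : Θ, 4⁻¹ := by simp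
  obtain ⟨θ, hθ⟩ : ∃ θ, early θ ≤ 4⁻¹ := by
    by_contra! hcon
    exact absurd hsum (not_le.mpr
      (ENNReal.sum_lt_sum_of_nonempty Finset.univ_nonempty fun θ _ => hcon θ))
  refine ⟨θ, ?_⟩
  have hlate : ∀ j ∈ Finset.range (K + 1), 4⁻¹ ≤ alg.probMoreThan (M θ) j := by
    intro j hj
    have h1 := (hsucc θ).trans (alg.successProb_le_add (hM θ) ε N r
      (Nat.lt_succ_iff.mp (Finset.mem_range.mp hj)))
    have h2 : (2⁻¹ : ℝ≥0∞) ≤ 4⁻¹ + alg.probMoreThan (M θ) j :=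
      h1.trans (add_le_add_left hθ _)
    have h3 : (2⁻¹ : ℝ≥0∞) = 4⁻¹ + 4⁻¹ := by
      rw [← two_mul, show (4 : ℝ≥0∞) = 2 * 2 by norm_num, ENNReal.mul_inv (by simp) (by simp),
        ← mul_assoc, ENNReal.mul_inv_cancel (by simp) (by simp), one_mul]
    rw [h3] at h2
    exact (ENNReal.add_le_add_iff_left (by simp)).mp h2
  calc ((K + 1 : ℕ) : ℝ≥0∞) * 4⁻¹ = ∑ _j ∈ Finset.range (K + 1), 4⁻¹ := by simp
    _ ≤ ∑ j ∈ Finset.range (K + 1), alg.probMoreThan (M θ) j := Finset.sum_le_sum hlate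
    _ ≤ alg.expectedEpisodes (M θ) := ENNReal.sum_le_tsum _

end Algorithm

/-! ### Perturbed uniform outcomes -/

/-- The uniform distribution on `Fin m × Bool`, tilted by the factor `1 + e` at the points
`(i, v i)` and by `1 - e` at the points `(i, !v i)`. -/
noncomputable def tiltedMass {m : ℕ} (e : ℝ) (v : Fin m → Bool) (p : Fin m × Bool) : ℝ :=
  (if p.2 = v p.1 then 1 + e else 1 - e) / (2 * m)

theorem tiltedMass_nonneg {m : ℕ} (e : Set.Icc (0 : ℝ) 1) (v : Fin m → Bool) (p : Fin m × Bool) :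
    0 ≤ tiltedMass e v p := by
  have h0 := e.2.1
  have h1 := e.2.2
  unfold tiltedMass
  apply div_nonneg _ (by positivity)
  split_ifs <;> linarith

theorem sum_bool_ite (v : Bool) (x y : ℝ) : ∑ b : Bool, (if b = v then x else y) = x + y := by
  cases v <;> simp [add_comm]

theorem sum_tiltedMass {m : ℕ} [NeZero m] (e : ℝ) (v : Fin m → Bool) :
    ∑ p, tiltedMass e v p = 1 := by
  have hm : (m : ℝ) ≠ 0 := Nat.cast_ne_zero.mpr (NeZero.ne m)
  unfold tiltedMass
  rw [← Finset.sum_div, Fintype.sum_prod_type]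
  simp only [sum_bool_ite]
  simp
  field_simp
  norm_num

/-- The law with masses `tiltedMass`, on outcomes to which a further point `none` has been added. -/
noncomputable def tilted {m : ℕ} [NeZero m] (e : Set.Icc (0 : ℝ) 1) (v : Fin m → Bool) :
    PMF (Option (Fin m × Bool)) :=
  PMF.ofFintype (fun o => o.elim 0 fun p => ENNReal.ofReal (tiltedMass e v p)) (by
    rw [Fintype.sum_option]
    simp only [Option.elim_none, Option.elim_some, zero_add]
    rw [← ENNReal.ofReal_sum_of_nonneg fun p _ => tiltedMass_nonneg e v p, sum_tiltedMass]
    simp)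

theorem tilted_none {m : ℕ} [NeZero m] (e : Set.Icc (0 : ℝ) 1) (v : Fin m → Bool) :
    tilted e v none = 0 := rfl

theorem tilted_some {m : ℕ} [NeZero m] (e : Set.Icc (0 : ℝ) 1) (v : Fin m → Bool)
    (p : Fin m × Bool) : tilted e v (some p) = ENNReal.ofReal (tiltedMass e v p) := rfl

/-- The integrand of the `χ²`-divergence of `tilted e v` from `tilted 0 v₀`, see
`tilted_mul_self`. -/
noncomputable def tiltedSq {m : ℕ} (e : ℝ) (v : Fin m → Bool) : Option (Fin m × Bool) → ℝ≥0∞ :=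
  fun o => o.elim 0 fun p => ENNReal.ofReal (2 * m * tiltedMass e v p ^ 2)

theorem tilted_mul_self {m : ℕ} [NeZero m] (e : Set.Icc (0 : ℝ) 1) (v v₀ : Fin m → Bool)
    (o : Option (Fin m × Bool)) :
    tilted e v o * tilted e v o = tiltedSq e v o * tilted 0 v₀ o := by
  have hm : (m : ℝ) ≠ 0 := Nat.cast_ne_zero.mpr (NeZero.ne m)
  rcases o with _ | p
  · simp [tilted_none]
  · simp only [tilted_some, tiltedSq, Option.elim_some]
    rw [← ENNReal.ofReal_mul (tiltedMass_nonneg e v p), ← ENNReal.ofReal_mul (by positivity)]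
    congr 1
    have : tiltedMass ((0 : Set.Icc (0 : ℝ) 1) : ℝ) v₀ p = 1 / (2 * m) := by
      simp [tiltedMass]
    rw [this]
    field_simp

theorem sum_tiltedSq {m : ℕ} [NeZero m] (e : ℝ) (v : Fin m → Bool) :
    ∑ o, tiltedSq e v o = ENNReal.ofReal (1 + e ^ 2) := by
  have hm : (m : ℝ) ≠ 0 := Nat.cast_ne_zero.mpr (NeZero.ne m)
  rw [Fintype.sum_option]
  simp only [tiltedSq, Option.elim_none, Option.elim_some, zero_add]
  rw [← ENNReal.ofReal_sum_of_nonneg fun p _ => by positivity]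
  congr 1
  unfold tiltedMass
  simp only [div_pow, ite_pow]
  rw [← Finset.mul_sum, ← Finset.sum_div, Fintype.sum_prod_type]
  simp only [sum_bool_ite]
  simp
  field_simp
  ring

/-- The outcome reward that tests for the tilt `u`; the outcome `none` has the reward `ρ`. -/
noncomputable def testReward {m : ℕ} (u : Fin m → Bool) (ρ : Set.Icc (0 : ℝ) 1) :
    Option (Fin m × Bool) → Set.Icc (0 : ℝ) 1 :=
  fun o => o.elim ρ fun p => if p.2 = u p.1 then 1 else 0

theorem sum_tilted_mul_testReward {m : ℕ} [NeZero m] (e : Set.Icc (0 : ℝ) 1) (u v : Fin m → Bool)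
    (ρ : Set.Icc (0 : ℝ) 1) :
    ∑ o, (tilted e v o).toReal * (testReward u ρ o : ℝ) =
      1 / 2 + e / 2 - e * hammingDist u v / m := by
  have hm : (m : ℝ) ≠ 0 := Nat.cast_ne_zero.mpr (NeZero.ne m)
  rw [Fintype.sum_option]
  simp only [tilted_none, tilted_some, testReward, Option.elim_some,
    ENNReal.toReal_ofReal (tiltedMass_nonneg e v _), ENNReal.toReal_zero, zero_mul, zero_add]
  rw [Fintype.sum_prod_type]
  have h1 : ∀ i : Fin m, ∑ b : Bool, tiltedMass e v (i, b) *
      ((if b = u i then 1 else 0 : Set.Icc (0 : ℝ) 1) : ℝ) =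
      (1 + e) / (2 * m) - e / m * (if u i ≠ v i then 1 else 0) := by
    intro i
    unfold tiltedMass
    cases hu : u i <;> cases hv : v i <;> simp [hv] <;> field_simp <;> ring
  simp only [h1]
  rw [Finset.sum_sub_distrib, ← Finset.mul_sum, Finset.sum_boole]
  simp only [Finset.sum_const, Finset.card_univ, Fintype.card_fin, nsmul_eq_mul, hammingDist]
  field_simp

/-! ### The hard instances -/

namespace TreeLayout

variable {m : ℕ} (T : TreeLayout S H (Option (Fin m × Bool)))

/-- All leaves but the leftmost one carry unknown outcome laws. -/
abbrev IsTestLeaf (s : Fin S) : Prop := 2 ^ T.depth < s.val ∧ s.val < 2 ^ (T.depth + 1)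

/-- The arms with an unknown outcome law. -/
abbrev Arm (A : ℕ) : Type := {s : Fin S // T.IsTestLeaf s} × Fin A

/-- The reward used to test the tilt `u` of an arm: a bonus `1` for playing this arm, and the
outcome reward `testReward u ρ` in each of the remaining stages. -/
noncomputable def query (A : ℕ) (ρ : Set.Icc (0 : ℝ) 1) (x : T.Arm A × (Fin m → Bool)) :
    Reward S A H :=
  fun _ s a => if s = x.1.1 ∧ a = x.1.2 then 1
    else Function.extend T.enc (testReward x.2 ρ) (fun _ => 0) s

theorem query_stageInvariant (ρ : Set.Icc (0 : ℝ) 1) (x : T.Arm A × (Fin m → Bool)) :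
    Reward.StageInvariant (T.query A ρ x) := fun _ _ => rfl

theorem query_enc (ρ : Set.Icc (0 : ℝ) 1) (x : T.Arm A × (Fin m → Bool)) (h : Fin H)
    (o : Option (Fin m × Bool)) (a : Fin A) :
    T.query A ρ x h (T.enc o) a = testReward x.2 ρ o := by
  have hx := x.1.1.2
  rw [query, if_neg, T.enc_injective.extend_apply]
  rintro ⟨h1, -⟩
  rcases T.enc_outside o with h' | h' <;> rw [h1] at h' <;> omega

theorem extend_enc_eq_zero {s : Fin S} (h1 : 1 ≤ s.val) (h2 : s.val < 2 ^ (T.depth + 1))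
    (f : Option (Fin m × Bool) → Set.Icc (0 : ℝ) 1) :
    Function.extend T.enc f (fun _ => 0) s = 0 := by
  rw [Function.extend_apply']
  rintro ⟨o, rfl⟩
  rcases T.enc_outside o with h' | h' <;> omega

variable [NeZero A]

/-- The decision rule `d` leads to the arm `x`. -/
def Hits (d : DetPolicy S A H) (x : T.Arm A) : Prop := T.leafOf d = x.1 ∧ T.actOf d = x.2

open Classical in
theorem totalReward_query_run (ρ : Set.Icc (0 : ℝ) 1) (x : T.Arm A × (Fin m → Bool))
    (d : DetPolicy S A H) (o : Option (Fin m × Bool)) :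
    totalReward (T.query A ρ x) (T.run d o) =
      (if T.Hits d x.1 then 1 else 0) + ((H - 1 - T.depth : ℕ) : ℝ) * (testReward x.2 ρ o : ℝ) := by
  have hterm : ∀ h : Fin H,
      (T.query A ρ x h ((T.run d o).1 h.castSucc) ((T.run d o).2 h) : ℝ) =
        (if h = T.leafStage then if T.Hits d x.1 then 1 else 0 else 0) +
          if h ∈ Finset.Ioi T.leafStage then (testReward x.2 ρ o : ℝ) else 0 := by
    intro h
    rcases lt_trichotomy h.val T.depth with hlt | heq | hgt
    · have hne : h ≠ T.leafStage := fun h' => by simp [h', leafStage] at hlt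
      have hn : h ∉ Finset.Ioi T.leafStage := by
        simp only [Finset.mem_Ioi, not_lt]
        exact hlt.le
      obtain ⟨l1, l2⟩ := T.run_level d o h.castSucc hlt.le
      simp only [Fin.val_castSucc] at l1 l2
      have hp : 2 ^ (h.val + 1) ≤ 2 ^ T.depth := Nat.pow_le_pow_right (by norm_num) hlt
      have hp' : 2 ^ T.depth ≤ 2 ^ (T.depth + 1) := Nat.pow_le_pow_right (by norm_num) (by omega)
      have hpos : 0 < 2 ^ h.val := by positivity
      have hx := x.1.1.2
      rw [if_neg hne, if_neg hn, query, if_neg, T.extend_enc_eq_zero (by omega) (by omega)]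
      · simp
      · rintro ⟨h1, -⟩
        rw [h1] at l2
        omega
    · obtain rfl : h = T.leafStage := Fin.ext heq
      have hl := T.isLeaf_leafOf d
      have hpos : 0 < 2 ^ T.depth := by positivity
      rw [if_pos rfl, if_neg (show T.leafStage ∉ Finset.Ioi T.leafStage by simp), T.run_leaf,
        T.run_act, query, T.extend_enc_eq_zero (hpos.trans_le hl.1) hl.2]
      have hiff : T.leafOf d = x.1.1 ∧ T.actOf d = x.1.2 ↔ T.Hits d x.1 := Iff.rfl
      simp only [hiff]
      split_ifs <;> simp
    · have hne : h ≠ T.leafStage := fun h' => by simp [h', leafStage] at hgt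
      have hm : h ∈ Finset.Ioi T.leafStage := Finset.mem_Ioi.mpr hgt
      rw [if_neg hne, if_pos hm, T.run_outcome d o h.castSucc hgt, query_enc, zero_add]
  unfold totalReward
  rw [Finset.sum_congr rfl fun h _ => hterm h, Finset.sum_add_distrib, Finset.sum_ite_eq',
    if_pos (Finset.mem_univ _), ← Finset.sum_filter, Finset.filter_univ_mem, Finset.sum_const,
    Fin.card_Ioi, nsmul_eq_mul]
  rfl

theorem sum_toReal_eq_one {α : Type*} [Fintype α] (p : PMF α) : ∑ a, (p a).toReal = 1 := by
  rw [← ENNReal.toReal_sum fun a _ => p.apply_ne_top a,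
    show ∑ a, p a = 1 from (tsum_fintype _).symm.trans p.tsum_coe,
    ENNReal.toReal_one]

open Classical in
/-- The probability with which `π` leads to the arm `x`. It does not depend on the unknown outcome
laws. -/
noncomputable def hitProb (π : Policy S A H) (x : T.Arm A) : ℝ :=
  ∑ d, if T.Hits d x then (π d).toReal else 0

variable [NeZero m]

/-- The outcome laws with parameter `θ`: the arms in the leftmost leaf lead to the outcome `none`,
any other arm has a tilted law whose tilt is the row of `θ` for this arm. -/
noncomputable def armLaw (e : Set.Icc (0 : ℝ) 1) (θ : T.Arm A × Fin m → Bool) (s : Fin S)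
    (a : Fin A) : PMF (Option (Fin m × Bool)) :=
  if h : T.IsTestLeaf s then tilted e fun i => θ ((⟨s, h⟩, a), i) else PMF.pure none

/-- The hard instance with tilt `e` and parameter `θ`. -/
noncomputable def hardMDP (e : Set.Icc (0 : ℝ) 1) (θ : T.Arm A × Fin m → Bool) : MDP S A H :=
  T.mdp A (T.armLaw e θ)

/-- The mean outcome reward of the arm that `d` plays. -/
noncomputable def armMean (e : Set.Icc (0 : ℝ) 1) (θ : T.Arm A × Fin m → Bool)
    (ρ : Set.Icc (0 : ℝ) 1) (u : Fin m → Bool) (d : DetPolicy S A H) : ℝ :=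
  ∑ o, (T.armLaw e θ (T.leafOf d) (T.actOf d) o).toReal * (testReward u ρ o : ℝ)

open Classical in
theorem value_query (e : Set.Icc (0 : ℝ) 1) (θ : T.Arm A × Fin m → Bool)
    (ρ : Set.Icc (0 : ℝ) 1) (x : T.Arm A × (Fin m → Bool)) (π : Policy S A H) :
    value (T.hardMDP e θ) (T.query A ρ x) π = ∑ d, (π d).toReal *
      ((if T.Hits d x.1 then 1 else 0) +
        ((H - 1 - T.depth : ℕ) : ℝ) * T.armMean e θ ρ x.2 d) := by
  unfold value
  refine Finset.sum_congr rfl fun d _ => ?_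
  congr 1
  rw [T.sum_traj_eq_sum_outcome d _ fun τ hτ => by
    rw [hardMDP, T.trajProb_eq_zero _ d τ hτ, ENNReal.toReal_zero, zero_mul]]
  simp only [hardMDP, T.trajProb_run, T.totalReward_query_run, mul_add, Finset.sum_add_distrib,
    ← Finset.sum_mul, sum_toReal_eq_one, one_mul, armMean, Finset.mul_sum]
  congr 1
  exact Finset.sum_congr rfl fun o _ => by ring

theorem value_query_pure (e : Set.Icc (0 : ℝ) 1) (θ : T.Arm A × Fin m → Bool)
    (ρ : Set.Icc (0 : ℝ) 1) (x : T.Arm A × (Fin m → Bool)) (d : DetPolicy S A H) :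
    value (T.hardMDP e θ) (T.query A ρ x) (PMF.pure d) =
      (open Classical in if T.Hits d x.1 then 1 else 0) +
        ((H - 1 - T.depth : ℕ) : ℝ) * T.armMean e θ ρ x.2 d := by
  classical
  rw [value_query, Finset.sum_eq_single d]
  · simp
  · intro d' _ hd'
    simp [PMF.pure_apply, hd']
  · simp

theorem armMean_of_hits (e : Set.Icc (0 : ℝ) 1) (θ : T.Arm A × Fin m → Bool)
    (ρ : Set.Icc (0 : ℝ) 1) (u : Fin m → Bool) {d : DetPolicy S A H} {x : T.Arm A}
    (h : T.Hits d x) : T.armMean e θ ρ u d =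
      1 / 2 + e / 2 - e * hammingDist u (fun i => θ (x, i)) / m := by
  obtain ⟨h1, h2⟩ := h
  rw [armMean, h1, h2, armLaw, dif_pos x.1.2, sum_tilted_mul_testReward]

theorem armMean_of_not_isTestLeaf (e : Set.Icc (0 : ℝ) 1) (θ : T.Arm A × Fin m → Bool)
    (ρ : Set.Icc (0 : ℝ) 1) (u : Fin m → Bool) {d : DetPolicy S A H}
    (h : ¬ T.IsTestLeaf (T.leafOf d)) : T.armMean e θ ρ u d = ρ := by
  classical
  rw [armMean, armLaw, dif_neg h, Finset.sum_eq_single none]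
  · simp [testReward]
  · intro o _ ho
    simp [PMF.pure_apply, ho]
  · simp

theorem armMean_le (e : Set.Icc (0 : ℝ) 1) (θ : T.Arm A × Fin m → Bool)
    (ρ : Set.Icc (0 : ℝ) 1) (u : Fin m → Bool) (d : DetPolicy S A H) :
    T.armMean e θ ρ u d ≤ max (ρ : ℝ) (1 / 2 + e / 2) := by
  by_cases h : T.IsTestLeaf (T.leafOf d)
  · rw [T.armMean_of_hits e θ ρ u (x := (⟨_, h⟩, T.actOf d)) ⟨rfl, rfl⟩]
    refine le_max_of_le_right (sub_le_self _ ?_)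
    have := e.2.1
    positivity
  · rw [T.armMean_of_not_isTestLeaf e θ ρ u h]
    exact le_max_left _ _

theorem value_query_le (e : Set.Icc (0 : ℝ) 1) (θ : T.Arm A × Fin m → Bool)
    (ρ : Set.Icc (0 : ℝ) 1) (x : T.Arm A × (Fin m → Bool)) (π : Policy S A H) :
    value (T.hardMDP e θ) (T.query A ρ x) π ≤
      T.hitProb π x.1 * (1 + ((H - 1 - T.depth : ℕ) : ℝ) *
        (1 / 2 + e / 2 - e * hammingDist x.2 (fun i => θ (x.1, i)) / m)) +
      (1 - T.hitProb π x.1) * (((H - 1 - T.depth : ℕ) : ℝ) * max (ρ : ℝ) (1 / 2 + e / 2)) := by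
  classical
  have hcompl : 1 - T.hitProb π x.1 = ∑ d, ((π d).toReal -
      if T.Hits d x.1 then (π d).toReal else 0) := by
    rw [Finset.sum_sub_distrib, sum_toReal_eq_one, hitProb]
  rw [value_query, hcompl, hitProb, Finset.sum_mul, Finset.sum_mul, ← Finset.sum_add_distrib]
  refine Finset.sum_le_sum fun d _ => ?_
  by_cases hd : T.Hits d x.1
  · rw [if_pos hd, if_pos hd, T.armMean_of_hits e θ ρ x.2 hd]
    simp
  · rw [if_neg hd, if_neg hd]
    have := T.armMean_le e θ ρ x.2 d
    have h0 : 0 ≤ (π d).toReal := ENNReal.toReal_nonneg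
    simp only [zero_add, zero_mul, sub_zero]
    gcongr

end TreeLayout

/-! ### Hamming balls -/

/-- A Hamming ball of radius `n / 4` contains an exponentially small part of `{0, 1} ^ n`. -/
theorem card_hammingBall_le {ι : Type*} [Fintype ι] [DecidableEq ι] (c : ι → Bool) :
    ((Finset.univ.filter fun θ : ι → Bool => 4 * hammingDist θ c ≤ Fintype.card ι).card : ℝ) ≤
      (9 / 5) ^ Fintype.card ι := by
  set n := Fintype.card ι with hn
  -- the weight `(5 / 6) ^ (4 * hammingDist θ c)` factorizes over the coordinates
  have htotal : ∑ θ : ι → Bool, ((5 : ℝ) / 6) ^ (4 * hammingDist θ c) =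
      (1 + (5 / 6) ^ 4) ^ n := by
    have hprod : ∀ θ : ι → Bool, ((5 : ℝ) / 6) ^ (4 * hammingDist θ c) =
        ∏ i, (if θ i ≠ c i then ((5 : ℝ) / 6) ^ 4 else 1) := by
      intro θ
      rw [pow_mul, hammingDist, ← Finset.prod_const, Finset.prod_filter]
    have hsum : ∀ i : ι, ∑ b : Bool, (if b ≠ c i then ((5 : ℝ) / 6) ^ 4 else 1) =
        1 + (5 / 6) ^ 4 := by
      intro i
      cases c i <;> simp [add_comm]
    have := Finset.prod_univ_sum (fun _ : ι => (Finset.univ : Finset Bool))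
      (fun i b => if b ≠ c i then ((5 : ℝ) / 6) ^ 4 else 1)
    rw [Fintype.piFinset_univ] at this
    rw [Finset.sum_congr rfl fun θ _ => hprod θ, ← this, Finset.prod_congr rfl fun i _ => hsum i,
      Finset.prod_const, Finset.card_univ]
  have hball : ((Finset.univ.filter fun θ : ι → Bool => 4 * hammingDist θ c ≤ n).card : ℝ) *
      (5 / 6) ^ n ≤ (1 + (5 / 6) ^ 4) ^ n := by
    rw [← htotal, ← nsmul_eq_mul, ← Finset.sum_const]
    calc _ ≤ ∑ θ ∈ Finset.univ.filter fun θ : ι → Bool => 4 * hammingDist θ c ≤ n,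
          ((5 : ℝ) / 6) ^ (4 * hammingDist θ c) :=
          Finset.sum_le_sum fun θ hθ => pow_le_pow_of_le_one (by norm_num) (by norm_num)
            (Finset.mem_filter.mp hθ).2
      _ ≤ _ := Finset.sum_le_sum_of_subset_of_nonneg (Finset.filter_subset _ _)
          fun _ _ _ => by positivity
  calc _ ≤ (1 + (5 / 6 : ℝ) ^ 4) ^ n / (5 / 6) ^ n := (le_div_iff₀ (by positivity)).mpr hball
    _ = ((1 + (5 / 6 : ℝ) ^ 4) / (5 / 6)) ^ n := (div_pow _ _ _).symm
    _ ≤ (9 / 5) ^ n := pow_le_pow_left₀ (by norm_num) (by norm_num) n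

/-! ### Decoding the parameter from near-optimal policies -/

namespace TreeLayout

variable {m : ℕ} (T : TreeLayout S H (Option (Fin m × Bool)))

section Decoding

variable [NeZero A] [NeZero m]

variable {e ρ : Set.Icc (0 : ℝ) 1} {ε : ℝ} {t : ℝ}

/-- Here `t` is the number of stages spent in the outcome, `e` the tilt and `ρ` the reward of the
outcome `none`. Up to the common term `t / 2`, the tested arm with a correct guess has the value
`1 + 12 * ε`, the leftmost leaf has the value `1 + 8 * ε`, and an arm without the bonus has at most
the value `12 * ε`, which is no more than that of the leftmost leaf. -/
theorem mul_max_eq (ht : 0 < t) (he : t * e = 24 * ε) (hρ : t * ρ = t / 2 + 1 + 8 * ε)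
    (hε' : ε ≤ 1 / 4) : t * max (ρ : ℝ) (1 / 2 + e / 2) = t / 2 + 1 + 8 * ε := by
  rw [max_eq_left, hρ]
  refine le_of_mul_le_mul_left ?_ ht
  linarith

/-- If `u` is the true tilt of the arm `x`, then a near-optimal policy for the query `(x, u)` plays
this arm most of the time. -/
theorem three_quarters_le_hitProb (hA : 2 ≤ A) (ht : t = ((H - 1 - T.depth : ℕ) : ℝ))
    (ht0 : 0 < t) (he : t * e = 24 * ε) (hρ : t * ρ = t / 2 + 1 + 8 * ε) (hε : 0 < ε)
    (hε' : ε ≤ 1 / 4) {θ : T.Arm A × Fin m → Bool} {x : T.Arm A} {π : Policy S A H}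
    (h : IsEpsOptimal (T.hardMDP e θ) (T.query A ρ (x, fun i => θ (x, i))) ε π) :
    3 / 4 ≤ T.hitProb π x := by
  obtain ⟨d, hd⟩ : ∃ d, T.Hits d x :=
    T.exists_detPolicy hA x.1 ⟨x.1.2.1.le, x.1.2.2⟩ x.2
  have h1 := (h (PMF.pure d)).trans (T.value_query_le e θ ρ _ π)
  rw [T.value_query_pure, if_pos hd, T.armMean_of_hits e θ ρ _ hd, ← ht,
    mul_max_eq ht0 he hρ hε'] at h1
  simp only [hammingDist_self, Nat.cast_zero, mul_zero, zero_div, sub_zero] at h1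
  have h2 : t * (1 / 2 + e / 2) = t / 2 + 12 * ε := by linarith
  rw [h2] at h1
  have h3 : ε * (3 - 4 * T.hitProb π x) ≤ 0 := by linarith
  by_contra hcon
  push Not at hcon
  nlinarith

/-- If a near-optimal policy for the query `(x, u)` plays the arm `x` most of the time, then `u` is
close to the true tilt of this arm, for otherwise the leftmost leaf would be better. -/
theorem hammingDist_le_of_hitProb (hA : 2 ≤ A) (ht : t = ((H - 1 - T.depth : ℕ) : ℝ))
    (ht0 : 0 < t) (he : t * e = 24 * ε) (hρ : t * ρ = t / 2 + 1 + 8 * ε) (hε : 0 < ε)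
    (hε' : ε ≤ 1 / 4) {θ : T.Arm A × Fin m → Bool} {x : T.Arm A} {u : Fin m → Bool}
    {π : Policy S A H} (h : IsEpsOptimal (T.hardMDP e θ) (T.query A ρ (x, u)) ε π)
    (hq : 3 / 4 ≤ T.hitProb π x) : 4 * hammingDist u (fun i => θ (x, i)) ≤ m := by
  have hS := T.two_pow_le
  have hpos : 0 < 2 ^ T.depth := by positivity
  rw [pow_succ] at hS
  obtain ⟨d, hd, -⟩ := T.exists_detPolicy hA (⟨2 ^ T.depth, by omega⟩ : Fin S)
    ⟨le_rfl, by simp only [pow_succ]; omega⟩ 0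
  have hnt : ¬ T.IsTestLeaf (T.leafOf d) := by
    rw [hd]
    exact fun h => lt_irrefl _ h.1
  have hnh : ¬ T.Hits d x := fun hh => hnt (by rw [hh.1]; exact x.1.2)
  have h1 := (h (PMF.pure d)).trans (T.value_query_le e θ ρ _ π)
  rw [T.value_query_pure, if_neg hnh, T.armMean_of_not_isTestLeaf e θ ρ _ hnt, ← ht,
    mul_max_eq ht0 he hρ hε', hρ] at h1
  have hm : (0 : ℝ) < m := Nat.cast_pos.mpr (NeZero.pos m)
  set k := hammingDist u fun i => θ (x, i) with hk
  set q := T.hitProb π x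
  have h2 : t * (1 / 2 + e / 2 - e * k / m) = t / 2 + 12 * ε - 24 * ε * (k / m) := by
    rw [← he]
    linear_combination (1 / 2) * he
  rw [h2] at h1
  have h3 : ε * (q * (24 * (k / m) - 4) - 1) ≤ 0 := by linarith
  have h4 : q * (24 * (k / m) - 4) ≤ 1 := by
    by_contra hcon
    push Not at hcon
    nlinarith
  have h5 : (k : ℝ) / m ≤ 1 / 4 := by
    by_contra hcon
    push Not at hcon
    nlinarith
  rw [div_le_iff₀ hm] at h5
  have : (4 * k : ℝ) ≤ m := by linarith
  exact_mod_cast this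

open Classical in
/-- Policies that are simultaneously near-optimal for all queries determine the parameter up to a
Hamming ball, hence are near-optimal in few of the hard instances. -/
theorem card_allEpsOptimal_le (hA : 2 ≤ A) (ht : t = ((H - 1 - T.depth : ℕ) : ℝ))
    (ht0 : 0 < t) (he : t * e = 24 * ε) (hρ : t * ρ = t / 2 + 1 + 8 * ε) (hε : 0 < ε)
    (hε' : ε ≤ 1 / 4) {N : ℕ} (x : Fin N ≃ T.Arm A × (Fin m → Bool))
    (π : Fin N → Policy S A H) :
    ((Finset.univ.filter fun θ =>
      AllEpsOptimal (T.hardMDP e θ) (fun i => T.query A ρ (x i)) ε π).card : ℝ) ≤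
      (9 / 5) ^ Fintype.card (T.Arm A × Fin m) := by
  let Cand : T.Arm A → (Fin m → Bool) → Prop := fun y u =>
    3 / 4 ≤ T.hitProb (π (x.symm (y, u))) y
  let c : T.Arm A × Fin m → Bool := fun p =>
    if h : ∃ u, Cand p.1 u then h.choose p.2 else false
  refine le_trans (Nat.cast_le.mpr (Finset.card_le_card ?_)) (card_hammingBall_le c)
  intro θ hθ
  have hall := (Finset.mem_filter.mp hθ).2
  have hopt : ∀ y u, IsEpsOptimal (T.hardMDP e θ) (T.query A ρ (y, u)) ε
      (π (x.symm (y, u))) := by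
    intro y u
    simpa using hall (x.symm (y, u))
  have hrow : ∀ y, 4 * hammingDist (fun i => c (y, i)) (fun i => θ (y, i)) ≤ m := by
    intro y
    have hex : ∃ u, Cand y u :=
      ⟨_, T.three_quarters_le_hitProb hA ht ht0 he hρ hε hε' (hopt y fun i => θ (y, i))⟩
    have hc : (fun i => c (y, i)) = hex.choose := by
      funext i
      simp only [c, dif_pos hex]
    rw [hc]
    exact T.hammingDist_le_of_hitProb hA ht ht0 he hρ hε hε' (hopt y _) hex.choose_spec
  have hsplit : hammingDist θ c =
      ∑ y, hammingDist (fun i => c (y, i)) (fun i => θ (y, i)) := by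
    rw [hammingDist_comm]
    simp only [hammingDist, Finset.card_filter]
    rw [Fintype.sum_prod_type]
  refine Finset.mem_filter.mpr ⟨Finset.mem_univ _, ?_⟩
  rw [hsplit, Finset.mul_sum, Fintype.card_prod, Fintype.card_fin]
  calc _ ≤ ∑ _y : T.Arm A, m := Finset.sum_le_sum fun y _ => hrow y
    _ = _ := by simp

end Decoding

/-! ### Information gained in one episode -/

theorem tsum_trajProb_mdp_le_one [NeZero A] (κ : Fin S → Fin A → PMF (Option (Fin m × Bool)))
    (d : DetPolicy S A H) : ∑' τ, trajProb (T.mdp A κ) d τ ≤ 1 := by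
  rw [tsum_fintype, T.sum_traj_eq_sum_outcome d _ (T.trajProb_eq_zero κ d)]
  simp only [T.trajProb_run]
  rw [← tsum_fintype (L := .unconditional _), PMF.tsum_coe]

/-- The integrand of the `χ²`-divergence of `armLaw e θ` from the untilted laws. -/
noncomputable def armSq (e : Set.Icc (0 : ℝ) 1) (θ : T.Arm A × Fin m → Bool) (s : Fin S)
    (a : Fin A) (o : Option (Fin m × Bool)) : ℝ≥0∞ :=
  if h : T.IsTestLeaf s then tiltedSq e (fun i => θ ((⟨s, h⟩, a), i)) o
  else PMF.pure none o

theorem armLaw_mul_self [NeZero m] (e : Set.Icc (0 : ℝ) 1) (θ θ₀ : T.Arm A × Fin m → Bool)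
    (s : Fin S) (a : Fin A) (o : Option (Fin m × Bool)) :
    T.armLaw e θ s a o * T.armLaw e θ s a o = T.armSq e θ s a o * T.armLaw 0 θ₀ s a o := by
  unfold armLaw armSq
  split_ifs with h
  · exact tilted_mul_self e _ _ o
  · rfl

theorem sum_armSq_le [NeZero m] (e : Set.Icc (0 : ℝ) 1) (θ : T.Arm A × Fin m → Bool) (s : Fin S)
    (a : Fin A) : ∑ o, T.armSq e θ s a o ≤ ENNReal.ofReal (1 + (e : ℝ) ^ 2) := by
  by_cases h : T.IsTestLeaf s
  · simp only [armSq, dif_pos h]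
    exact (sum_tiltedSq _ _).le
  · simp only [armSq, dif_neg h]
    rw [← tsum_fintype (L := .unconditional _), PMF.tsum_coe, ← ENNReal.ofReal_one]
    exact ENNReal.ofReal_le_ofReal (le_add_of_nonneg_right (sq_nonneg _))

open Classical in
/-- `armSq` as a function of the trajectory. -/
noncomputable def trajSq [NeZero A] (e : Set.Icc (0 : ℝ) 1) (θ : T.Arm A × Fin m → Bool)
    (d : DetPolicy S A H) (τ : Traj S A H) : ℝ≥0∞ :=
  if h : ∃ o, τ = T.run d o then T.armSq e θ (T.leafOf d) (T.actOf d) h.choose else 0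

theorem trajSq_run [NeZero A] (e : Set.Icc (0 : ℝ) 1) (θ : T.Arm A × Fin m → Bool)
    (d : DetPolicy S A H) (o : Option (Fin m × Bool)) :
    T.trajSq e θ d (T.run d o) = T.armSq e θ (T.leafOf d) (T.actOf d) o := by
  have h : ∃ o', T.run d o = T.run d o' := ⟨o, rfl⟩
  rw [trajSq, dif_pos h, ← T.run_injective d h.choose_spec]

theorem trajProb_mul_self [NeZero A] [NeZero m] (e : Set.Icc (0 : ℝ) 1)
    (θ θ₀ : T.Arm A × Fin m → Bool) (d : DetPolicy S A H) (τ : Traj S A H) :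
    trajProb (T.hardMDP e θ) d τ * trajProb (T.hardMDP e θ) d τ =
      T.trajSq e θ d τ * trajProb (T.hardMDP 0 θ₀) d τ := by
  unfold hardMDP
  by_cases h : ∃ o, τ = T.run d o
  · obtain ⟨o, rfl⟩ := h
    rw [T.trajProb_run, T.trajProb_run, T.trajSq_run]
    exact T.armLaw_mul_self e θ θ₀ _ _ o
  · push Not at h
    rw [T.trajProb_eq_zero _ d τ h, T.trajProb_eq_zero _ d τ h, mul_zero, mul_zero]

theorem tsum_trajSq_le [NeZero A] [NeZero m] (e : Set.Icc (0 : ℝ) 1) (θ : T.Arm A × Fin m → Bool)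
    (d : DetPolicy S A H) :
    ∑' τ, T.trajSq e θ d τ ≤ ENNReal.ofReal (1 + (e : ℝ) ^ 2) := by
  rw [tsum_fintype, T.sum_traj_eq_sum_outcome d]
  · simp only [T.trajSq_run]
    exact T.sum_armSq_le e θ _ _
  · intro τ hτ
    rw [trajSq, dif_neg (by push Not; exact hτ)]

/-- On some hard instance, an algorithm that learns from arbitrarily many rewards plays more than
`K / 4` episodes on average, as long as the likelihood ratios gathered in `K` episodes are small
compared to the number of hard instances. -/
theorem exists_le_expectedEpisodes [NeZero A] [NeZero m] (hA : 2 ≤ A)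
    {e ρ : Set.Icc (0 : ℝ) 1} {ε t : ℝ} (ht : t = ((H - 1 - T.depth : ℕ) : ℝ)) (ht0 : 0 < t)
    (he : t * e = 24 * ε)
    (hρ : t * ρ = t / 2 + 1 + 8 * ε) (hε : 0 < ε) (hε' : ε ≤ 1 / 4) {K : ℕ}
    (hK : 64 * (1 + (e : ℝ) ^ 2) ^ K ≤ (10 / 9) ^ Fintype.card (T.Arm A × Fin m))
    (alg : Algorithm S A H)
    (hlearns : alg.Learns {M | M.StageInvariant} {r | Reward.StageInvariant r} ε (1 / 2)) :
    ∃ M : MDP S A H, M.StageInvariant ∧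
      ((K + 1 : ℕ) : ℝ≥0∞) * 4⁻¹ ≤ alg.expectedEpisodes M := by
  classical
  set n := Fintype.card (T.Arm A × Fin m) with hn
  let x : Fin (Fintype.card (T.Arm A × (Fin m → Bool))) ≃ T.Arm A × (Fin m → Bool) :=
    (Fintype.equivFin _).symm
  have hB : (1 : ℝ) ≤ 1 + (e : ℝ) ^ 2 := le_add_of_nonneg_right (sq_nonneg _)
  have hL : (0 : ℝ) < 8 * (1 + (e : ℝ) ^ 2) ^ K := by positivity
  obtain ⟨θ, hθ⟩ := alg.exists_le_expectedEpisodes (M := T.hardMDP (A := A) e)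
    (M₀ := T.hardMDP 0 fun _ => false) (w₂ := T.trajSq e)
    (fun θ d => T.tsum_trajProb_mdp_le_one _ d) (fun d => T.tsum_trajProb_mdp_le_one _ d)
    (fun θ d τ => T.trajProb_mul_self e θ _ d τ)
    (B := ENNReal.ofReal (1 + (e : ℝ) ^ 2)) (by simpa using hB)
    (fun θ d => T.tsum_trajSq_le e θ d) (ε := ε) (fun i => T.query A ρ (x i))
    (G := ENNReal.ofReal ((9 / 5) ^ n))
    (fun π => by
      rw [← ENNReal.ofReal_natCast]
      exact ENNReal.ofReal_le_ofReal
        (T.card_allEpsOptimal_le hA ht ht0 he hρ hε hε' x π))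
    (L := ENNReal.ofReal (8 * (1 + (e : ℝ) ^ 2) ^ K))
    (by simpa using hL) ENNReal.ofReal_ne_top K
    (by
      have hcard : (Fintype.card (T.Arm A × Fin m → Bool) : ℝ≥0∞) = ENNReal.ofReal (2 ^ n) := by
        rw [Fintype.card_fun, Fintype.card_bool, ← hn]
        norm_num
      rw [hcard, ← ENNReal.ofReal_inv_of_pos hL, ← ENNReal.ofReal_pow (by positivity),
        ← ENNReal.ofReal_mul (by positivity), ← ENNReal.ofReal_mul (by positivity),
        ← ENNReal.ofReal_mul (by positivity), ← ENNReal.ofReal_add (by positivity) (by positivity),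
        show (4⁻¹ : ℝ≥0∞) = ENNReal.ofReal 4⁻¹ by
          rw [ENNReal.ofReal_inv_of_pos (by norm_num)]; simp,
        ← ENNReal.ofReal_mul (by positivity)]
      apply ENNReal.ofReal_le_ofReal
      have h2 : ((10 : ℝ) / 9) ^ n * (9 / 5) ^ n = 2 ^ n := by
        rw [← mul_pow]
        norm_num
      have h3 : 64 * (1 + (e : ℝ) ^ 2) ^ K * (9 / 5) ^ n ≤ 2 ^ n := by
        rw [← h2]
        gcongr
      have h4 : (8 * (1 + (e : ℝ) ^ 2) ^ K)⁻¹ * (1 + (e : ℝ) ^ 2) ^ K = 1 / 8 := by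
        field_simp
      rw [h4]
      linarith)
    (fun θ => by
      have := hlearns (T.hardMDP e θ) (T.mdp_stageInvariant _) _ (fun i => T.query A ρ (x i))
        fun i => T.query_stageInvariant ρ (x i)
      refine le_trans (le_of_eq ?_) this
      rw [show (1 : ℝ) - 1 / 2 = 2⁻¹ by norm_num, ENNReal.ofReal_inv_of_pos (by norm_num)]
      simp)
  exact ⟨_, T.mdp_stageInvariant _, hθ⟩

end TreeLayout

/-! ### Choice of the tree and of the constants -/

/-- A layout with depth `k + 1` and `2 ^ (k + 1) + 1` outcomes: the outcome `none` is placed on the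
state `0`, the other outcomes are placed right after the leaves. -/
def treeLayout (k : ℕ) (hH : k + 1 < H) (hS : 3 * 2 ^ (k + 1) ≤ S) :
    TreeLayout S H (Option (Fin (2 ^ k) × Bool)) where
  depth := k + 1
  depth_lt := hH
  two_pow_le := by rw [pow_succ]; omega
  enc o := match o with
    | none => ⟨0, by have : 0 < 2 ^ (k + 1) := by positivity
                     omega⟩
    | some (i, b) => ⟨2 ^ (k + 2) + (2 * i.val + b.toNat), by
        have := i.isLt
        have hb := Bool.toNat_le b
        simp only [pow_succ] at *
        omega⟩
  enc_injective := by
    have h2 : 0 < 2 ^ (k + 2) := by positivity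
    rintro (_ | ⟨i, b⟩) (_ | ⟨j, c⟩) h
    · rfl
    · have := congrArg Fin.val h
      simp only at this
      omega
    · have := congrArg Fin.val h
      simp only at this
      omega
    · have h' := congrArg Fin.val h
      have hb := Bool.toNat_le b
      have hc := Bool.toNat_le c
      simp only at h'
      have hij : i = j := Fin.ext (by omega)
      have hbc' : b.toNat = c.toNat := by omega
      have hbc : b = c := by
        revert hbc'
        cases b <;> cases c <;> simp
      rw [hij, hbc]
  enc_outside o := match o with
    | none => Or.inl rfl
    | some (i, b) => Or.inr (Nat.le_add_right _ _)

theorem le_card_arm {m : ℕ} (T : TreeLayout S H (Option (Fin m × Bool)))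
    (A : ℕ) : (2 ^ T.depth - 1) * A ≤ Fintype.card (T.Arm A) := by
  rw [Fintype.card_prod, Fintype.card_fin]
  refine Nat.mul_le_mul_right _ ?_
  have hS := T.two_pow_le
  rw [pow_succ] at hS
  let f : Fin (2 ^ T.depth - 1) → {s : Fin S // T.IsTestLeaf s} := fun i =>
    ⟨⟨2 ^ T.depth + 1 + i.val, by omega⟩, by
      unfold TreeLayout.IsTestLeaf
      simp only [pow_succ]
      omega⟩
  have hf : Function.Injective f := by
    intro i j h
    have := congrArg (fun s => s.1.val) h
    simp only [f] at this
    exact Fin.ext (by omega)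
  simpa using Fintype.card_le_of_injective f hf

/-- The exponential inequality behind the choice of the number of episodes: `e ^ 2 * K ≤ n / 20`
keeps the likelihood ratios of `K` episodes small compared to `(10 / 9) ^ n`. -/
theorem mul_one_add_sq_pow_le {e : ℝ} {K n : ℕ} (hK : e ^ 2 * K ≤ n / 20) (hn : 1134 ≤ n) :
    64 * (1 + e ^ 2) ^ K ≤ (10 / 9 : ℝ) ^ n := by
  have h1 : (1 + e ^ 2) ^ K ≤ Real.exp (1 / 20) ^ n := by
    rw [← Real.exp_nat_mul]
    calc (1 + e ^ 2) ^ K ≤ Real.exp (e ^ 2) ^ K := by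
          refine pow_le_pow_left₀ (by positivity) ?_ K
          linarith [Real.add_one_le_exp (e ^ 2)]
      _ = Real.exp (K * e ^ 2) := (Real.exp_nat_mul _ _).symm
      _ ≤ _ := Real.exp_le_exp.mpr (by linarith)
  have h2 : Real.exp (1 / 20) ≤ 20 / 19 := by
    have h := Real.add_one_le_exp (-(1 / 20) : ℝ)
    rw [Real.exp_neg, ← one_div, le_div_iff₀ (Real.exp_pos _)] at h
    linarith
  have h3 : (64 : ℝ) ≤ (19 / 18) ^ n := by
    have h := one_add_mul_le_pow (a := (1 / 18 : ℝ)) (by norm_num) n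
    have hn' : (1134 : ℝ) ≤ n := by exact_mod_cast hn
    rw [show (19 / 18 : ℝ) = 1 + 1 / 18 by norm_num]
    linarith
  calc 64 * (1 + e ^ 2) ^ K ≤ (19 / 18) ^ n * (20 / 19) ^ n := by
        refine mul_le_mul h3 (h1.trans (pow_le_pow_left₀ (Real.exp_pos _).le h2 n))
          (by positivity) (by positivity)
    _ = (10 / 9) ^ n := by
        rw [← mul_pow]
        norm_num

/-- The lower bound for a tree of depth `k + 1`, which fills a fixed part of the state space and
leaves half of the episode for the outcome. -/
theorem lower_bound_of_tree {k : ℕ} {ε : ℝ} (hA : 2 ≤ A) (hS : 3 * 2 ^ (k + 1) ≤ S)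
    (hS' : S < 6 * 2 ^ (k + 1)) (hS₀ : 400 ≤ S) (hH : 2 * (k + 2) ≤ H) (hH₀ : 12 ≤ H)
    (hε : 0 < ε) (hε' : ε ≤ 1 / 4) (alg : Algorithm S A H)
    (hlearns : alg.Learns {M | M.StageInvariant} {r | Reward.StageInvariant r} ε (1 / 2)) :
    ∃ M : MDP S A H, M.StageInvariant ∧
      ENNReal.ofReal (1 / 26542080 * ((S : ℝ) ^ 2 * A * (H : ℝ) ^ 2 / ε ^ 2)) ≤
        alg.expectedEpisodes M := by
  have : NeZero A := ⟨by omega⟩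
  have : NeZero (2 ^ k) := ⟨by positivity⟩
  set T := treeLayout (S := S) k (show k + 1 < H by omega) hS
  set n := Fintype.card (T.Arm A × Fin (2 ^ k)) with hn
  set t : ℝ := ((H - 1 - T.depth : ℕ) : ℝ) with ht
  have ht_ge : (H : ℝ) / 2 ≤ t := by
    have h : H ≤ 2 * (H - 1 - T.depth) := by
      change H ≤ 2 * (H - 1 - (k + 1))
      omega
    have h' : (H : ℝ) ≤ 2 * t := by
      rw [ht]
      exact_mod_cast h
    linarith
  have hH₀' : (12 : ℝ) ≤ H := by exact_mod_cast hH₀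
  have ht6 : 6 ≤ t := by linarith
  have ht0 : 0 < t := by linarith
  -- one quarter of the square of the number of leaves bounds the number of bits per action
  have hn_ge : (S : ℝ) ^ 2 * A / 144 ≤ n := by
    have h1 : (2 ^ (k + 1) - 1) * A * 2 ^ k ≤ n := by
      rw [hn, Fintype.card_prod, Fintype.card_fin]
      exact Nat.mul_le_mul_right _ (le_card_arm T A)
    have h2 : 2 ^ k * A * 2 ^ k ≤ n := by
      refine le_trans ?_ h1
      gcongr
      have : 0 < 2 ^ k := by positivity
      rw [pow_succ]
      omega
    have h3 : (2 : ℝ) ^ k * A * 2 ^ k ≤ n := by exact_mod_cast h2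
    have h4 : (S : ℝ) ≤ 12 * 2 ^ k := by
      have : S ≤ 12 * 2 ^ k := by
        rw [pow_succ] at hS'
        omega
      exact_mod_cast this
    have h5 : (S : ℝ) ^ 2 ≤ (12 * 2 ^ k) ^ 2 := by gcongr
    have h6 : (S : ℝ) ^ 2 * A ≤ (12 * 2 ^ k) ^ 2 * A := by gcongr
    nlinarith
  have hA' : (2 : ℝ) ≤ A := by exact_mod_cast hA
  have hS₀' : (400 : ℝ) ≤ S := by exact_mod_cast hS₀
  have hn1134 : 1134 ≤ n := by
    have h1 : (400 : ℝ) ^ 2 ≤ (S : ℝ) ^ 2 := by gcongr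
    have h2 : (400 : ℝ) ^ 2 * 2 ≤ (S : ℝ) ^ 2 * A := by gcongr
    have : (1134 : ℝ) ≤ n := by linarith
    exact_mod_cast this
  let e : Set.Icc (0 : ℝ) 1 := ⟨24 * ε / t, by positivity, by
    rw [div_le_one ht0]
    linarith⟩
  let ρ : Set.Icc (0 : ℝ) 1 := ⟨1 / 2 + (1 + 8 * ε) / t, by positivity, by
    have : (1 + 8 * ε) / t ≤ 1 / 2 := by
      rw [div_le_iff₀ ht0]
      linarith
    linarith⟩
  have he_val : (e : ℝ) = 24 * ε / t := rfl
  have hρ_val : (ρ : ℝ) = 1 / 2 + (1 + 8 * ε) / t := rfl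
  have he : t * e = 24 * ε := by
    rw [he_val]
    field_simp
  have hρ : t * ρ = t / 2 + 1 + 8 * ε := by
    rw [hρ_val]
    field_simp
    ring
  have he0 : 0 < (e : ℝ) ^ 2 := by
    rw [he_val]
    positivity
  set K := ⌊(n : ℝ) / 20 / (e : ℝ) ^ 2⌋₊ with hKdef
  have hK : (e : ℝ) ^ 2 * K ≤ n / 20 := by
    have := Nat.floor_le (show 0 ≤ (n : ℝ) / 20 / (e : ℝ) ^ 2 by positivity)
    rwa [← hKdef, le_div_iff₀ he0, mul_comm] at this
  obtain ⟨M, hM, hbound⟩ := T.exists_le_expectedEpisodes hA ht ht0 he hρ hε hε'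
    (mul_one_add_sq_pow_le hK hn1134) alg hlearns
  refine ⟨M, hM, le_trans ?_ hbound⟩
  have hK1 : (n : ℝ) / 20 / (e : ℝ) ^ 2 ≤ ((K + 1 : ℕ) : ℝ) := by
    push_cast
    exact (Nat.lt_floor_add_one _).le
  have hreal : 1 / 26542080 * ((S : ℝ) ^ 2 * A * (H : ℝ) ^ 2 / ε ^ 2) ≤
      ((K + 1 : ℕ) : ℝ) * 4⁻¹ := by
    have h1 : (H : ℝ) ^ 2 / 4 ≤ t ^ 2 := by
      have : ((H : ℝ) / 2) ^ 2 ≤ t ^ 2 := by gcongr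
      linarith
    have h2 : (n : ℝ) / 20 / (e : ℝ) ^ 2 = n * t ^ 2 / (11520 * ε ^ 2) := by
      rw [he_val]
      field_simp
      norm_num
    have h3 : (S : ℝ) ^ 2 * A / 144 * ((H : ℝ) ^ 2 / 4) ≤ n * t ^ 2 := by gcongr
    have h4 : (S : ℝ) ^ 2 * A / 144 * ((H : ℝ) ^ 2 / 4) / (11520 * ε ^ 2) ≤
        n * t ^ 2 / (11520 * ε ^ 2) := by gcongr
    calc 1 / 26542080 * ((S : ℝ) ^ 2 * A * (H : ℝ) ^ 2 / ε ^ 2)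
        = (S : ℝ) ^ 2 * A / 144 * ((H : ℝ) ^ 2 / 4) / (11520 * ε ^ 2) * 4⁻¹ := by
          field_simp
          norm_num
      _ ≤ ((K + 1 : ℕ) : ℝ) * 4⁻¹ := by
          gcongr
          exact h4.trans (h2 ▸ hK1)
  calc _ ≤ ENNReal.ofReal (((K + 1 : ℕ) : ℝ) * 4⁻¹) := ENNReal.ofReal_le_ofReal hreal
    _ = _ := by
      rw [ENNReal.ofReal_mul (by positivity), ENNReal.ofReal_natCast,
        ENNReal.ofReal_inv_of_pos (by norm_num)]
      simp

end RewardFree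

theorem mainTheorem2 :
    ∃ C : ℝ, 0 < C ∧ ∃ c : ℝ, 0 < c ∧
      ∀ (S A H : ℕ) (ε : ℝ), 2 ≤ A → C * Real.logb 2 (A : ℝ) ≤ (S : ℝ) →
        C * Real.logb 2 (S : ℝ) ≤ (H : ℝ) → 0 < ε → ε ≤ min (1 / 4) ((H : ℝ) / 48) →
        ∀ alg : RewardFree.Algorithm S A H,
          alg.Learns {M | M.StageInvariant} {r | RewardFree.Reward.StageInvariant r} ε (1 / 2) →
          ∃ M : RewardFree.MDP S A H, M.StageInvariant ∧
            ENNReal.ofReal (c * ((S : ℝ) ^ 2 * (A : ℝ) * (H : ℝ) ^ 2 / ε ^ 2)) ≤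
              alg.expectedEpisodes M := by
  refine ⟨400, by norm_num, 1 / 26542080, by norm_num, ?_⟩
  intro S A H ε hA hS hH hε hε' alg hlearns
  have hlogA : 1 ≤ Real.logb 2 (A : ℝ) := by
    rw [Real.le_logb_iff_rpow_le (by norm_num) (by positivity), Real.rpow_one]
    exact_mod_cast hA
  have hS₀ : 400 ≤ S := by
    have : (400 : ℝ) ≤ S := by linarith
    exact_mod_cast this
  -- the depth is maximal subject to `3 * 2 ^ depth ≤ S`
  obtain ⟨k, hk⟩ : ∃ k, Nat.log 2 (S / 3) = k + 1 :=
    Nat.exists_eq_succ_of_ne_zero (Nat.log_pos (by norm_num) (by omega)).ne'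
  have hlow : 2 ^ (k + 1) ≤ S / 3 := hk ▸ Nat.pow_log_le_self 2 (by omega)
  have hupp : S / 3 < 2 ^ (k + 2) := by
    have := Nat.lt_pow_succ_log_self (b := 2) (by norm_num) (S / 3)
    rwa [hk] at this
  have hlogS : ((k + 1 : ℕ) : ℝ) ≤ Real.logb 2 (S : ℝ) := by
    rw [Real.le_logb_iff_rpow_le (by norm_num) (by positivity), Real.rpow_natCast]
    have : 2 ^ (k + 1) ≤ S := by omega
    exact_mod_cast this
  have hH' : 400 * (k + 1) ≤ H := by
    have : (400 : ℝ) * ((k + 1 : ℕ) : ℝ) ≤ H := by linarith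
    exact_mod_cast this
  refine RewardFree.lower_bound_of_tree hA ?_ ?_ hS₀ ?_ ?_ hε (hε'.trans (min_le_left _ _)) alg
    hlearns (k := k)
  · omega
  · rw [pow_succ] at hupp
    omega
  · omega
  · omega
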